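/- Equip $\mathbb{R}^2$ with the Euclidean norm. A function $f:[0,1]^2\to\mathbb{R}$ is called smooth if it is differentiable and $\|\nabla f(x)-\nabla f(y)\|\le\|x-y\|$ for all $x,y\in[0,1]^2$. For $\epsilon>0$, a point $x\in[0,1]^2$ is an $\epsilon$-stationary point of $f$ if for every $\epsilon'>\epsilon$ there is a neighborhood $N$ of $x$ in $[0,1]^2$ with $f(x)\le f(y)+\epsilon'\|x-y\|$ for all $y\in N$. A deterministic algorithm sequentially queries points of $[0,1]^2$ and receives the value of $f$ at each of them; its next query point, and the point of $[0,1]^2$ that it currently proposes as a solution, are arbitrary functions of the answers received so far. Let $\mathcal{Q}(\mathcal{A},f,\epsilon)\in\{0,1,2,\dots\}\cup\{\infty\}$ be the number of queries made by $\mathcal{A}$ in order to find an $\epsilon$-stationary point of $f$, i.e. the least $t$ such that the point proposed after $t$ queries is an $\epsilon$-stationary point. A randomized algorithm is a random choice of a deterministic algorithm, and the randomized query complexity is $$\mathcal{Q}_{\mathrm{rand}}(\epsilon):=\inf_{\mathcal{A}\text{ randomized}}\ \sup_{f\text{ smooth}}\ \mathbb{E}_{\mathcal{A}}\left[\mathcal{Q}(\mathcal{A},f,\epsilon)\right].$$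 Theorem. Let $h:\{1,2,\dots\}\to(0,\infty)$ be a (not necessarily strictly) decreasing function with $\sum_{k=1}^\infty \frac{h(k)}{k}<\infty$, and set $S_h(n):=\sum_{k=1}^n\frac{1}{k\,h(k)}$. Then, as $\epsilon\to0^+$, $$\mathcal{Q}_{\mathrm{rand}}(\epsilon)=\Omega\left(\frac{1}{\sqrt{\epsilon}\cdot S_h\left(\left\lceil 1/\sqrt{\epsilon}\right\rceil\right)}\right),$$ where the implied constant and the range of $\epsilon$ may depend on $h$. In particular, as $\epsilon\to0^+$, $$\mathcal{Q}_{\mathrm{rand}}(\epsilon)=\Omega\left(\frac{1}{\sqrt{\epsilon}\,\log^3(1/\epsilon)}\right).$$ -/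

import Mathlib

open scoped ENNReal Topology

universe u

/-- The plane `ℝ²` with its Euclidean norm. -/
abbrev Plane : Type := EuclideanSpace ℝ (Fin 2)

/-- The closed unit square `[0,1]²`. -/
def unitSquare : Set Plane := {x | ∀ i, x i ∈ Set.Icc (0 : ℝ) 1}

/-- `f` is smooth on `[0,1]²`: it is differentiable there (one-sided at the boundary) and its
gradient is `1`-Lipschitz for the Euclidean norm. Only the values of `f` on `[0,1]²` matter. The
norm of a difference of derivatives (as functionals) is the Euclidean norm of the difference of
gradients. -/
def IsSmooth (f : Plane → ℝ) : Prop :=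
  DifferentiableOn ℝ f unitSquare ∧
    ∀ x ∈ unitSquare, ∀ y ∈ unitSquare,
      ‖fderivWithin ℝ f unitSquare x - fderivWithin ℝ f unitSquare y‖ ≤ ‖x - y‖

/-- `x ∈ [0,1]²` is an `ε`-stationary point of `f` on `[0,1]²`: for every `ε' > ε` one has
`f x ≤ f y + ε' ‖x - y‖` for all `y` in some neighborhood of `x` in `[0,1]²`. -/
def IsStationaryPoint (f : Plane → ℝ) (ε : ℝ) (x : Plane) : Prop :=
  x ∈ unitSquare ∧ ∀ ε' > ε, ∀ᶠ y in 𝓝[unitSquare] x, f x ≤ f y + ε' * ‖x - y‖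

/-- A deterministic algorithm with access to a value oracle. As a function of the list of answers
received so far, it gives the point to be queried next, and the point which the algorithm
currently proposes as its solution. No restriction is put on its computations.

An algorithm that stops with an output is the case where the proposed point is that output from
the stopping time on; an algorithm that has to query the point which it finds is the case where
the proposed point is the point queried last. -/
structure DetAlgorithm where
  /-- the next point to be queried -/
  query : List ℝ → unitSquare
  /-- the point currently proposed as a solution -/
  output : List ℝ → unitSquare

/-- The answers to the first `t` queries of the algorithm `A` when the oracle is `f`. -/
def DetAlgorithm.answers (A : DetAlgorithm) (f : Plane → ℝ) : ℕ → List ℝ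
  | 0 => []
  | t + 1 => A.answers f t ++ [f (A.query (A.answers f t))]

/-- `𝒬(A, f, ε)`: the number of queries made by `A` in order to find an `ε`-stationary point of
`f`, that is, the least `t` such that the point proposed after `t` queries is an `ε`-stationary
point (`∞` if there is no such `t`). -/
noncomputable def DetAlgorithm.queries (A : DetAlgorithm) (f : Plane → ℝ) (ε : ℝ) : ℝ≥0∞ :=
  ⨅ (t : ℕ) (_ : IsStationaryPoint f ε (A.output (A.answers f t))), (t : ℝ≥0∞)

/-- A randomized algorithm (for accuracy `ε`): a deterministic algorithm chosen at random on an
arbitrary probability space. The only requirement is that its number of queries on each smooth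
function is a random variable, so that the expectation makes sense. -/
structure RandomizedAlgorithm (ε : ℝ) where
  /-- the sample space -/
  Ω : Type u
  /-- its events -/
  mΩ : MeasurableSpace Ω
  /-- its probability -/
  μ : MeasureTheory.Measure Ω
  isProb : MeasureTheory.IsProbabilityMeasure μ
  /-- the algorithm run for a given outcome of the random choice -/
  alg : Ω → DetAlgorithm
  aemeasurable_queries :
    ∀ f : Plane → ℝ, IsSmooth f → AEMeasurable (fun ω => (alg ω).queries f ε) μ

/-- The expected number of queries made by a randomized algorithm to find an `ε`-stationary point
of `f`. -/
noncomputable def RandomizedAlgorithm.expectedQueries {ε : ℝ} (A : RandomizedAlgorithm.{u} ε)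
    (f : Plane → ℝ) : ℝ≥0∞ :=
  letI := A.mΩ
  ∫⁻ ω, (A.alg ω).queries f ε ∂A.μ

/-- The randomized query complexity
`𝒬_rand(ε) = inf_{A randomized} sup_{f smooth} 𝔼_A [𝒬(A, f, ε)]`. -/
noncomputable def queryComplexityRand (ε : ℝ) : ℝ≥0∞ :=
  ⨅ A : RandomizedAlgorithm.{u} ε, ⨆ (f : Plane → ℝ) (_ : IsSmooth f), A.expectedQueries f

/-- `S_h(n) = ∑_{k=1}^n 1 / (k h(k))`. -/
noncomputable def sumRecip (h : ℕ → ℝ) (n : ℕ) : ℝ :=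
  ∑ k ∈ Finset.Icc 1 n, 1 / ((k : ℝ) * h k)

/-! A steadily deepening valley of width `w = 40√ε` is carved along a random curve from the corner
`(0,0)` to the right edge, in a background tilted too steeply to have stationary points away from
that corner. Moving along the valley lowers `f`, so `ε`-stationary points lie only at its far end
(`valley_stationary`). Outside the valley an answer is the background value and carries no
information about the curve.

The slope of the curve is `1/4` plus independent random tents on dyadic blocks of `2^j` columns,
with amplitude up to `c h(2^j)`. Condensation makes these amplitudes summable, which keeps the slope
bounded and `f` smooth (`valley_isSmooth`). Given the curve up to column `s`, a point `k` columns
further is preceded by an unseen block of length comparable to `k`. That block spreads the height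
over order `k h(k)` valley widths, so the point hits the valley with probability `O(1/(k h(k)))`
(`card_hit_le_sum_hitBound`).

To finish, an algorithm must pass each column `s < N`, where `N = ⌊1/w⌋₊`, and each passage costs a
constant mean amount of hitting probability (`quarter_le_sum_hitBound`). One point supplies at most
`C * sumRecip h N` summed over all `s` (`sum_hitBound_le`). Hence the mean number of steps is at
least of order `N / sumRecip h N`, and averaging over the curve transfers this to randomized
algorithms (`le_queryComplexityRand`). -/

/-! ### Profiles: tents, their antiderivatives, and the cross-section of the valley -/

/-- The square of the positive part. -/
noncomputable def posSq (t : ℝ) : ℝ := (max t 0) ^ 2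

theorem hasDerivAt_posSq (t : ℝ) : HasDerivAt posSq (2 * max t 0) t := by
  rcases lt_trichotomy t 0 with ht | rfl | ht
  · have h : posSq =ᶠ[𝓝 t] fun _ => 0 := by
      filter_upwards [eventually_lt_nhds ht] with s hs
      simp [posSq, max_eq_right hs.le]
    rw [max_eq_right ht.le, mul_zero]
    exact (hasDerivAt_const t (0 : ℝ)).congr_of_eventuallyEq h
  · rw [max_self, mul_zero, hasDerivAt_iff_isLittleO]
    refine Asymptotics.IsBigO.trans_isLittleO (g := fun s : ℝ => s ^ 2) ?_ ?_
    · refine Asymptotics.IsBigO.of_bound 1 (Filter.Eventually.of_forall fun s => ?_)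
      simp only [posSq, max_self, Real.norm_eq_abs, smul_zero, sub_zero, one_mul, ne_eq,
        OfNat.ofNat_ne_zero, not_false_eq_true, zero_pow]
      rw [abs_pow, abs_pow]
      have : |max s 0| ≤ |s| := by
        rw [abs_of_nonneg (le_max_right s 0)]
        exact max_le (le_abs_self s) (abs_nonneg s)
      gcongr
    · simpa using Asymptotics.isLittleO_pow_id (one_lt_two) (𝕜 := ℝ)
  · have h : posSq =ᶠ[𝓝 t] fun s => s ^ 2 := by
      filter_upwards [eventually_gt_nhds ht] with s hs
      simp [posSq, max_eq_left hs.le]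
    rw [max_eq_left ht.le]
    simpa using (hasDerivAt_pow 2 t).congr_of_eventuallyEq h

theorem abs_max_zero_sub_le (s t : ℝ) : |max s 0 - max t 0| ≤ |s - t| :=
  abs_max_sub_max_le_abs s t 0

/-- The tent function on `[0,1]`. -/
noncomputable def tent (t : ℝ) : ℝ := max (1 - |2 * t - 1|) 0

/-- The antiderivative of `tent` that vanishes on the negative half-line. -/
noncomputable def ramp (t : ℝ) : ℝ := posSq t - 2 * posSq (t - 1 / 2) + posSq (t - 1)

theorem hasDerivAt_ramp (t : ℝ) : HasDerivAt ramp (tent t) t := by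
  have h1 := hasDerivAt_posSq t
  have h2 := ((hasDerivAt_posSq (t - 1 / 2)).comp t ((hasDerivAt_id t).sub_const (1 / 2))).const_mul 2
  have h3 := (hasDerivAt_posSq (t - 1)).comp t ((hasDerivAt_id t).sub_const 1)
  have := (h1.sub h2).add h3
  refine HasDerivAt.congr_deriv (f := ramp) this ?_
  unfold tent
  rcases abs_cases (2 * t - 1) with ⟨e, _⟩ | ⟨e, _⟩ <;> rw [e] <;>
  rcases max_cases t 0 with ⟨e1, _⟩ | ⟨e1, _⟩ <;> rw [e1] <;>
  rcases max_cases (t - 1 / 2) 0 with ⟨e2, _⟩ | ⟨e2, _⟩ <;> rw [e2] <;>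
  rcases max_cases (t - 1) 0 with ⟨e3, _⟩ | ⟨e3, _⟩ <;> rw [e3] <;>
  first
  | (rw [max_eq_left (by linarith)]; linarith)
  | (rw [max_eq_right (by linarith)]; linarith)

theorem ramp_of_nonpos {t : ℝ} (ht : t ≤ 0) : ramp t = 0 := by
  unfold ramp posSq
  rw [max_eq_right ht, max_eq_right (by linarith), max_eq_right (by linarith)]; norm_num

theorem ramp_of_one_le {t : ℝ} (ht : 1 ≤ t) : ramp t = 1 / 2 := by
  unfold ramp posSq
  rw [max_eq_left (by linarith), max_eq_left (by linarith), max_eq_left (by linarith)]; ring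

theorem tent_nonneg (t : ℝ) : 0 ≤ tent t := le_max_right _ _

theorem tent_le_one (t : ℝ) : tent t ≤ 1 :=
  max_le (by linarith [abs_nonneg (2 * t - 1)]) zero_le_one

theorem floor_eq_of_tent_ne_zero {t : ℝ} {m : ℕ} (h : tent (t - m) ≠ 0) : ⌊t⌋ = (m : ℤ) := by
  unfold tent at h
  have h1 : 0 < 1 - |2 * (t - m) - 1| := by
    by_contra hc
    exact h (max_eq_right (not_lt.mp hc))
  have h2 := abs_lt.mp (sub_pos.mp h1)
  rw [Int.floor_eq_iff]
  push_cast
  constructor <;> linarith [h2.1, h2.2]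

theorem abs_tent_sub_le (s t : ℝ) : |tent s - tent t| ≤ 2 * |s - t| := by
  unfold tent
  refine (abs_max_zero_sub_le _ _).trans ?_
  have : 1 - |2 * s - 1| - (1 - |2 * t - 1|) = -(|2 * s - 1| - |2 * t - 1|) := by ring
  rw [this, abs_neg]
  refine (abs_abs_sub_abs_le _ _).trans (le_of_eq ?_)
  rw [show 2 * s - 1 - (2 * t - 1) = 2 * (s - t) by ring, abs_mul, abs_two]

/-- The profile of a valley: `1` at the center and `0` outside `[-1,1]`. -/
noncomputable def well (u : ℝ) : ℝ := posSq (1 - u ^ 2)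

/-- The derivative of `well`. -/
noncomputable def wellDeriv (u : ℝ) : ℝ := -4 * u * max (1 - u ^ 2) 0

theorem hasDerivAt_well (u : ℝ) : HasDerivAt well (wellDeriv u) u := by
  have := (hasDerivAt_posSq (1 - u ^ 2)).comp u ((hasDerivAt_pow 2 u).const_sub 1)
  refine HasDerivAt.congr_deriv (f := well) this ?_
  unfold wellDeriv
  push_cast
  ring

theorem well_of_one_le_abs {u : ℝ} (hu : 1 ≤ |u|) : well u = 0 := by
  have : 1 ≤ u ^ 2 := by rw [← sq_abs]; nlinarith
  unfold well posSq
  rw [max_eq_right (by linarith)]; norm_num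

/-- Clamping `u` to `[-1,1]` turns the derivative into a cubic on a bounded interval; the size and
Lipschitz bounds become polynomial inequalities. -/
theorem wellDeriv_eq (u : ℝ) :
    wellDeriv u = -4 * (max (-1) (min u 1) - max (-1) (min u 1) ^ 3) := by
  unfold wellDeriv
  rcases le_total u (-1) with h | h
  · rw [min_eq_left (by linarith), max_eq_left h, max_eq_right (by nlinarith)]; norm_num
  rcases le_total u 1 with h' | h'
  · rw [min_eq_left h', max_eq_right h, max_eq_left (by nlinarith)]; ring
  · rw [min_eq_right h', max_eq_right (by norm_num : (-1 : ℝ) ≤ 1),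
      max_eq_right (by nlinarith)]
    norm_num

theorem abs_wellDeriv_le (u : ℝ) : |wellDeriv u| ≤ 2 := by
  rw [wellDeriv_eq]
  set c := max (-1) (min u 1)
  have h1 : -1 ≤ c := le_max_left _ _
  have h2 : c ≤ 1 := max_le (by norm_num) (min_le_right _ _)
  rw [abs_le]
  constructor
  · nlinarith [mul_nonneg (by linarith : 0 ≤ 1 + c) (sq_nonneg (2 * c - 1))]
  · nlinarith [mul_nonneg (by linarith : 0 ≤ 1 - c) (sq_nonneg (2 * c + 1))]

theorem abs_wellDeriv_sub_le (u v : ℝ) : |wellDeriv u - wellDeriv v| ≤ 8 * |u - v| := by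
  rw [wellDeriv_eq, wellDeriv_eq]
  have hcd : |max (-1) (min u 1) - max (-1) (min v 1)| ≤ |u - v| := by
    refine le_trans ?_ (abs_min_sub_min_le_max u 1 v 1 |>.trans (by simp))
    rw [max_comm (-1) (min u 1), max_comm (-1) (min v 1)]
    exact abs_max_sub_max_le_abs _ _ _
  set c := max (-1) (min u 1)
  set d := max (-1) (min v 1)
  have h1 : -1 ≤ c := le_max_left _ _
  have h2 : c ≤ 1 := max_le (by norm_num) (min_le_right _ _)
  have h3 : -1 ≤ d := le_max_left _ _
  have h4 : d ≤ 1 := max_le (by norm_num) (min_le_right _ _)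
  have : -4 * (c - c ^ 3) - -4 * (d - d ^ 3) = (c - d) * (4 * (c ^ 2 + c * d + d ^ 2 - 1)) := by ring
  rw [this, abs_mul, mul_comm]
  have h5 : |4 * (c ^ 2 + c * d + d ^ 2 - 1)| ≤ 8 := by
    rw [abs_le]; constructor <;> nlinarith
  gcongr

theorem abs_well_sub_le (u v : ℝ) : |well u - well v| ≤ 2 * |u - v| := by
  have := convex_univ.norm_image_sub_le_of_norm_hasDerivWithin_le (f := well) (f' := wellDeriv)
    (C := 2) (x := v) (y := u) (fun x _ => (hasDerivAt_well x).hasDerivWithinAt)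
    (fun x _ => abs_wellDeriv_le x) trivial trivial
  simpa [Real.norm_eq_abs] using this

/-! ### Smoothness and stationarity on the square -/

theorem coord_abs_le_norm (z : Plane) (i : Fin 2) : |z i| ≤ ‖z‖ := by
  simpa [Real.norm_eq_abs] using PiLp.norm_apply_le z i

theorem convex_unitSquare : Convex ℝ unitSquare := by
  intro x hx y hy a b ha hb hab i
  have := (convex_Icc (0 : ℝ) 1) (hx i) (hy i) ha hb hab
  simpa using this

theorem uniqueDiffOn_unitSquare : UniqueDiffOn ℝ unitSquare := by
  refine uniqueDiffOn_convex convex_unitSquare ⟨!₂[1 / 2, 1 / 2], ?_⟩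
  have hopen : IsOpen {x : Plane | ∀ i, x i ∈ Set.Ioo (0 : ℝ) 1} := by
    simp only [Set.ofPred_forall]
    exact isOpen_iInter_of_finite fun i => isOpen_Ioo.preimage (by fun_prop)
  refine interior_maximal (t := {x : Plane | ∀ i, x i ∈ Set.Ioo (0 : ℝ) 1})
    (fun x hx i => Set.Ioo_subset_Icc_self (hx i)) hopen ?_
  intro i
  fin_cases i <;> norm_num

/-- The linear functional with gradient `(a, b)`. -/
noncomputable def planeFunctional (a b : ℝ) : Plane →L[ℝ] ℝ :=
  a • EuclideanSpace.proj 0 + b • EuclideanSpace.proj 1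

theorem planeFunctional_apply (a b : ℝ) (v : Plane) : planeFunctional a b v = a * v 0 + b * v 1 := by
  simp [planeFunctional]

theorem norm_planeFunctional_sub_le (a b a' b' : ℝ) :
    ‖planeFunctional a b - planeFunctional a' b'‖ ≤ |a - a'| + |b - b'| := by
  refine ContinuousLinearMap.opNorm_le_bound _ (by positivity) fun v => ?_
  rw [sub_apply, planeFunctional_apply, planeFunctional_apply, Real.norm_eq_abs]
  have : a * v 0 + b * v 1 - (a' * v 0 + b' * v 1) = (a - a') * v 0 + (b - b') * v 1 := by ring
  rw [this]
  refine (abs_add_le _ _).trans ?_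
  rw [abs_mul, abs_mul, add_mul]
  gcongr
  · exact coord_abs_le_norm v 0
  · exact coord_abs_le_norm v 1

theorem isSmooth_of_hasFDerivAt {f : Plane → ℝ} {a b : Plane → ℝ}
    (hf : ∀ z, HasFDerivAt f (planeFunctional (a z) (b z)) z)
    (hab : ∀ z ∈ unitSquare, ∀ z' ∈ unitSquare, |a z - a z'| + |b z - b z'| ≤ ‖z - z'‖) :
    IsSmooth f := by
  refine ⟨fun z _ => (hf z).differentiableAt.differentiableWithinAt, fun z hz z' hz' => ?_⟩
  rw [(hf z).hasFDerivWithinAt.fderivWithin (uniqueDiffOn_unitSquare z hz),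
    (hf z').hasFDerivWithinAt.fderivWithin (uniqueDiffOn_unitSquare z' hz')]
  exact (norm_planeFunctional_sub_le _ _ _ _).trans (hab z hz z' hz')

/-- A feasible direction of descent with slope steeper than `ε` excludes `ε`-stationarity. -/
theorem not_isStationaryPoint_of_descent {f : Plane → ℝ} {L : Plane →L[ℝ] ℝ} {z v : Plane}
    {ε t₀ : ℝ} (hf : HasFDerivAt f L z) (ht₀ : 0 < t₀) (hz : z ∈ unitSquare)
    (hv : z + t₀ • v ∈ unitSquare) (hL : L v < -(ε * ‖v‖)) : ¬ IsStationaryPoint f ε z := by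
  rintro ⟨-, hst⟩
  have hv0 : 0 < ‖v‖ := by
    rw [norm_pos_iff]
    rintro rfl
    simp at hL
  obtain ⟨ε', h1, h2⟩ : ∃ ε', ε < ε' ∧ ε' < -L v / ‖v‖ :=
    exists_between (by rw [lt_div_iff₀ hv0]; linarith)
  rw [lt_div_iff₀ hv0] at h2
  have hγ : HasDerivAt (fun t : ℝ => z + t • v) v 0 := by
    simpa using ((hasDerivAt_id (0 : ℝ)).smul_const v).const_add z
  have hd : HasDerivAt (fun t : ℝ => f (z + t • v)) (L v) 0 := by
    have hf' : HasFDerivAt f L (z + (0 : ℝ) • v) := by simpa using hf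
    exact hf'.comp_hasDerivAt 0 hγ
  have htend : Filter.Tendsto (fun t : ℝ => z + t • v) (𝓝[>] 0) (𝓝[unitSquare] z) := by
    refine tendsto_nhdsWithin_iff.mpr ⟨?_, ?_⟩
    · have := hγ.continuousAt.tendsto
      simp only [zero_smul, add_zero] at this
      exact this.mono_left nhdsWithin_le_nhds
    · filter_upwards [Ioo_mem_nhdsGT ht₀] with t ht
      have := convex_unitSquare.add_smul_mem hz hv (t := t / t₀)
        ⟨div_nonneg ht.1.le ht₀.le, (div_le_one ht₀).mpr ht.2.le⟩
      rwa [smul_smul, div_mul_cancel₀ _ ht₀.ne'] at this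
  have hev := htend.eventually (hst ε' h1)
  have hslope := (hasDerivAt_iff_tendsto_slope.mp hd).mono_left
    (nhdsWithin_mono 0 (fun t (ht : 0 < t) => ne_of_gt ht) : 𝓝[>] (0 : ℝ) ≤ 𝓝[≠] 0)
  have : -(ε' * ‖v‖) ≤ L v := by
    refine ge_of_tendsto hslope ?_
    filter_upwards [hev, self_mem_nhdsWithin] with t ht (ht0 : 0 < t)
    rw [slope_def_field, zero_smul, add_zero, sub_zero, le_div_iff₀ ht0]
    rw [sub_add_cancel_left, norm_neg, norm_smul, Real.norm_eq_abs, abs_of_pos ht0] at ht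
    linarith
  linarith

/-! ### The valley landscape -/

/-- The landscape with a valley of width `w` along the graph of `g`. -/
noncomputable def valley (ε w : ℝ) (g : ℝ → ℝ) (z : Plane) : ℝ :=
  ε * (4 * (z 0 + z 1) - (1 + 20 * z 0) * well ((z 1 - g (z 0)) / w))

theorem valley_of_far {ε w : ℝ} {g : ℝ → ℝ} {z : Plane} (hw : 0 < w) (h : w < |z 1 - g (z 0)|) :
    valley ε w g z = ε * (4 * (z 0 + z 1)) := by
  unfold valley
  rw [well_of_one_le_abs, mul_zero, sub_zero]
  rw [abs_div, abs_of_pos hw, le_div_iff₀ hw]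
  linarith

theorem hasFDerivAt_valley {ε w : ℝ} {g p : ℝ → ℝ} (hg : ∀ x, HasDerivAt g (p x) x) (z : Plane) :
    HasFDerivAt (valley ε w g)
      (planeFunctional
        (ε * (4 - 20 * well ((z 1 - g (z 0)) / w)
          + (1 + 20 * z 0) * wellDeriv ((z 1 - g (z 0)) / w) * p (z 0) / w))
        (ε * (4 - (1 + 20 * z 0) * wellDeriv ((z 1 - g (z 0)) / w) / w))) z := by
  have h0 : HasFDerivAt (fun z : Plane => z 0) (EuclideanSpace.proj 0 : Plane →L[ℝ] ℝ) z :=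
    (EuclideanSpace.proj 0 : Plane →L[ℝ] ℝ).hasFDerivAt
  have h1 : HasFDerivAt (fun z : Plane => z 1) (EuclideanSpace.proj 1 : Plane →L[ℝ] ℝ) z :=
    (EuclideanSpace.proj 1 : Plane →L[ℝ] ℝ).hasFDerivAt
  have hu := (h1.sub ((hg (z 0)).comp_hasFDerivAt z h0)).mul_const w⁻¹
  have hwell := (hasDerivAt_well ((z 1 - g (z 0)) / w)).comp_hasFDerivAt z
    (f := fun z : Plane => (z 1 - g (z 0)) / w) hu
  have := (((h0.add h1).const_mul 4).sub (((h0.const_mul 20).const_add 1).mul hwell)).const_mul ε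
  refine this.congr_fderiv ?_
  ext v
  simp [planeFunctional]
  ring

/-- The gradient varies at rate at most `874 * ε / w ^ 2`, which `w = 40√ε` brings below `1`. A
slope `p` with Lipschitz constant `1/w` costs no more than the profile itself does. -/
theorem valley_isSmooth {ε w : ℝ} {g p : ℝ → ℝ} (hw : 0 < w) (hw1 : w ≤ 1)
    (hε : 1600 * ε = w ^ 2) (hg : ∀ x, HasDerivAt g (p x) x)
    (hp : ∀ x, p x ∈ Set.Icc (1 / 4 : ℝ) (3 / 4)) (hpl : ∀ x x', |p x - p x'| ≤ |x - x'| / w) :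
    IsSmooth (valley ε w g) := by
  refine isSmooth_of_hasFDerivAt (hasFDerivAt_valley hg) fun z hz z' hz' => ?_
  set δ := ‖z - z'‖
  have hδ : 0 ≤ δ := norm_nonneg _
  have hx : |z 0 - z' 0| ≤ δ := coord_abs_le_norm (z - z') 0
  have hy : |z 1 - z' 1| ≤ δ := coord_abs_le_norm (z - z') 1
  have hpn : ∀ x, |p x| ≤ 1 := fun x => abs_le.mpr ⟨by linarith [(hp x).1], by linarith [(hp x).2]⟩
  have hgl : |g (z 0) - g (z' 0)| ≤ δ := by
    have := convex_univ.norm_image_sub_le_of_norm_hasDerivWithin_le (f := g) (f' := p)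
      (C := 1) (x := z' 0) (y := z 0) (fun x _ => (hg x).hasDerivWithinAt)
      (fun x _ => hpn x) trivial trivial
    rw [one_mul, Real.norm_eq_abs, Real.norm_eq_abs] at this
    exact this.trans hx
  have hD : |1 + 20 * z 0| ≤ 21 := abs_le.mpr ⟨by linarith [(hz 0).1], by linarith [(hz 0).2]⟩
  have hDl : |(1 + 20 * z 0) - (1 + 20 * z' 0)| ≤ 20 * δ := by
    rw [show (1 + 20 * z 0) - (1 + 20 * z' 0) = 20 * (z 0 - z' 0) by ring, abs_mul]
    simpa using hx
  have hpd : |p (z 0) - p (z' 0)| ≤ δ / w := (hpl _ _).trans (by gcongr)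
  have hul : |(z 1 - g (z 0)) / w - (z' 1 - g (z' 0)) / w| ≤ 2 * δ / w := by
    rw [← sub_div, abs_div, abs_of_pos hw]
    gcongr
    rw [show z 1 - g (z 0) - (z' 1 - g (z' 0)) = (z 1 - z' 1) - (g (z 0) - g (z' 0)) by ring]
    refine (abs_sub _ _).trans (by linarith)
  generalize (z 1 - g (z 0)) / w = u at *
  generalize (z' 1 - g (z' 0)) / w = u' at *
  generalize p (z 0) = q at *
  have hpz := hpn (z' 0)
  generalize p (z' 0) = q' at *
  generalize 1 + 20 * z 0 = D at *
  generalize 1 + 20 * z' 0 = D' at *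
  have hC : |well u - well u'| ≤ 4 * δ / w := (abs_well_sub_le u u').trans (by
    calc 2 * |u - u'| ≤ 2 * (2 * δ / w) := by gcongr
      _ = 4 * δ / w := by ring)
  have hE : |wellDeriv u - wellDeriv u'| ≤ 16 * δ / w := (abs_wellDeriv_sub_le u u').trans (by
    calc 8 * |u - u'| ≤ 8 * (2 * δ / w) := by gcongr
      _ = 16 * δ / w := by ring)
  have hd := abs_wellDeriv_le u'
  have hδw : δ ≤ δ / w := by rw [le_div_iff₀ hw]; nlinarith
  have hP : |D * wellDeriv u - D' * wellDeriv u'| ≤ 376 * (δ / w) := by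
    rw [show D * wellDeriv u - D' * wellDeriv u' =
      D * (wellDeriv u - wellDeriv u') + (D - D') * wellDeriv u' by ring]
    refine (abs_add_le _ _).trans ?_
    rw [abs_mul, abs_mul]
    calc _ ≤ 21 * (16 * δ / w) + 20 * δ * 2 := by gcongr
      _ = 336 * (δ / w) + 40 * δ := by ring
      _ ≤ _ := by linarith
  have hPb : |D * wellDeriv u| ≤ 42 := by
    rw [abs_mul]
    calc _ ≤ 21 * (2 : ℝ) := by gcongr; exact abs_wellDeriv_le u
      _ = 42 := by norm_num
  have hQ : |D * wellDeriv u * q - D' * wellDeriv u' * q'| ≤ 418 * (δ / w) := by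
    rw [show D * wellDeriv u * q - D' * wellDeriv u' * q' =
      D * wellDeriv u * (q - q') + (D * wellDeriv u - D' * wellDeriv u') * q' by ring]
    refine (abs_add_le _ _).trans ?_
    rw [abs_mul, abs_mul _ q']
    calc _ ≤ 42 * (δ / w) + 376 * (δ / w) * 1 := by gcongr
      _ = _ := by ring
  have hε0 : 0 < ε := by nlinarith
  rw [← mul_sub, ← mul_sub, abs_mul, abs_mul, abs_of_pos hε0]
  have h1 : |4 - 20 * well u + D * wellDeriv u * q / w - (4 - 20 * well u' + D' * wellDeriv u' * q' / w)|
      ≤ 498 * (δ / w) / w := by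
    rw [show 4 - 20 * well u + D * wellDeriv u * q / w - (4 - 20 * well u' + D' * wellDeriv u' * q' / w)
      = (D * wellDeriv u * q - D' * wellDeriv u' * q') / w - 20 * (well u - well u') by ring]
    refine (abs_sub _ _).trans ?_
    rw [abs_div, abs_of_pos hw, abs_mul, abs_of_pos (by norm_num : (0:ℝ) < 20)]
    calc _ ≤ 418 * (δ / w) / w + 20 * (4 * δ / w) := by gcongr
      _ = 418 * (δ / w) / w + 80 * (δ / w) := by ring
      _ ≤ 418 * (δ / w) / w + 80 * (δ / w / w) := by gcongr
      _ = _ := by ring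
  have h2 : |4 - D * wellDeriv u / w - (4 - D' * wellDeriv u' / w)| ≤ 376 * (δ / w) / w := by
    rw [show 4 - D * wellDeriv u / w - (4 - D' * wellDeriv u' / w)
      = -((D * wellDeriv u - D' * wellDeriv u') / w) by ring, abs_neg, abs_div, abs_of_pos hw]
    gcongr
  calc _ ≤ ε * (498 * (δ / w) / w) + ε * (376 * (δ / w) / w) := by gcongr
    _ = 874 * ε * δ / w ^ 2 := by field_simp; ring
    _ ≤ δ := by rw [div_le_iff₀ (by positivity), ← hε]; nlinarith

/-- Each region has a descent direction: down when above the curve, left on the outer part of the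
lower side, and along the curve near its bottom. Only the last can be blocked, at the right edge. -/
theorem valley_stationary {ε w : ℝ} {g p : ℝ → ℝ} (hw : 0 < w) (hw1 : w ≤ 1 / 40) (hε : 0 < ε)
    (hg : ∀ x, HasDerivAt g (p x) x) (hp : ∀ x, p x ∈ Set.Icc (1 / 4 : ℝ) (3 / 4))
    (hg0 : g 0 = 0) {z : Plane} (hz : IsStationaryPoint (valley ε w g) ε z) :
    z 0 = 1 ∧ |z 1 - g (z 0)| ≤ w := by
  by_contra hcon
  refine absurd hz ?_
  have hzs := hz.1
  have hx := hzs 0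
  have hy := hzs 1
  have hf := hasFDerivAt_valley (ε := ε) (w := w) hg z
  have hmono : Monotone g := monotone_of_hasDerivAt_nonneg hg fun x => by
    have := (hp x).1
    simp only [Pi.zero_apply]
    linarith
  have hgnn : 0 ≤ g (z 0) := hg0 ▸ hmono hx.1
  have hgle : g (z 0) ≤ 3 / 4 := by
    have := convex_univ.norm_image_sub_le_of_norm_hasDerivWithin_le (f := g) (f' := p)
      (C := 3 / 4) (x := 0) (y := z 0) (fun x _ => (hg x).hasDerivWithinAt)
      (fun x _ => abs_le.mpr ⟨by linarith [(hp x).1], (hp x).2⟩) trivial trivial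
    rw [hg0, sub_zero, sub_zero, Real.norm_eq_abs, Real.norm_eq_abs, abs_of_nonneg hgnn,
      abs_of_nonneg hx.1] at this
    linarith [hx.2]
  have hpz := hp (z 0)
  set u := (z 1 - g (z 0)) / w with hu
  have huw : z 1 - g (z 0) = u * w := by rw [hu]; field_simp
  have hD : 1 ≤ 1 + 20 * z 0 := by linarith [hx.1]
  rcases lt_or_ge 0 u with hu0 | hu0
  · have hyp : 0 < z 1 := by nlinarith
    refine not_isStationaryPoint_of_descent (v := !₂[0, -1]) hf hyp hzs ?_ ?_
    · intro i
      fin_cases i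
      · simpa using hx
      · simp
    · have hn : ‖(!₂[0, -1] : Plane)‖ = 1 := by simp [EuclideanSpace.norm_eq]
      rw [hn, planeFunctional_apply]
      have hneg : (1 + 20 * z 0) * wellDeriv u / w ≤ 0 := by
        refine div_nonpos_of_nonpos_of_nonneg (mul_nonpos_of_nonneg_of_nonpos (by linarith) ?_) hw.le
        unfold wellDeriv
        nlinarith [mul_nonneg hu0.le (le_max_right (1 - u ^ 2) 0)]
      simp
      nlinarith
  rcases lt_or_ge (well u) (1 / 2) with hc | hc
  · have hxp : 0 < z 0 := by
      refine lt_of_le_of_ne hx.1 fun h0 => ?_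
      have : u = 0 := by
        rw [← h0, hg0, sub_zero] at huw
        nlinarith [hy.1]
      rw [this] at hc
      norm_num [well, posSq] at hc
    refine not_isStationaryPoint_of_descent (v := !₂[-1, 0]) hf hxp hzs ?_ ?_
    · intro i
      fin_cases i
      · simp
      · simpa using hy
    · have hn : ‖(!₂[-1, 0] : Plane)‖ = 1 := by simp [EuclideanSpace.norm_eq]
      rw [hn, planeFunctional_apply]
      -- The valley wall has slope of order `1/w` and outweighs the deepening term because `w ≤
      -- 1/40`.
      have key : 20 * well u ≤ (1 + 20 * z 0) * wellDeriv u * p (z 0) / w := by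
        rw [le_div_iff₀ hw]
        unfold well posSq wellDeriv at *
        set t := max (1 - u ^ 2) 0 with ht
        have ht0 : 0 ≤ t := le_max_right _ _
        have ht1 : t ≤ 1 := max_le (by nlinarith) zero_le_one
        have hut : 1 / 2 ≤ -u := by
          by_contra hcc
          have h1 : u ^ 2 < 1 / 4 := by nlinarith
          have h2 : 3 / 4 ≤ t := le_trans (by linarith) (le_max_left (1 - u ^ 2) 0)
          nlinarith
        have e1 : 20 * t ^ 2 * w ≤ t / 2 := by nlinarith [mul_nonneg ht0 (by linarith : 0 ≤ 1 - t)]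
        have e2 : 2 * t ≤ -4 * u * t := by nlinarith
        have e3 : -4 * u * t ≤ (1 + 20 * z 0) * (-4 * u * t) :=
          le_mul_of_one_le_left (by linarith) hD
        nlinarith [hpz.1]
      simp
      nlinarith
  · have hu1 : -1 < u := by
      by_contra hcc
      rw [well_of_one_le_abs (by rw [abs_of_nonpos hu0]; linarith)] at hc
      norm_num at hc
    have hx1 : z 0 < 1 := by
      refine lt_of_le_of_ne hx.2 fun h1 => hcon ⟨h1, ?_⟩
      rw [huw, abs_mul, abs_of_pos hw, abs_of_nonpos hu0]
      nlinarith
    have hyg : z 1 ≤ g (z 0) := by nlinarith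
    set t₀ := min (1 - z 0) (1 / 4)
    have ht₀ : 0 < t₀ := lt_min (by linarith) (by norm_num)
    refine not_isStationaryPoint_of_descent (v := !₂[1, p (z 0)]) hf ht₀ hzs ?_ ?_
    · have ha : t₀ ≤ 1 - z 0 := min_le_left _ _
      have hb : t₀ ≤ 1 / 4 := min_le_right _ _
      intro i
      fin_cases i
      · simp
        constructor <;> linarith [hx.1]
      · simp
        constructor <;> nlinarith [hy.1, hpz.1, hpz.2]
    · have hn : ‖(!₂[1, p (z 0)] : Plane)‖ ≤ 2 := by
        rw [EuclideanSpace.norm_eq, Real.sqrt_le_left (by norm_num)]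
        simp
        nlinarith [hpz.1, hpz.2]
      rw [planeFunctional_apply]
      simp
      -- Along the tangent direction the profile terms cancel, leaving a gain `20 * well u ≥ 10`
      -- against a tilt `4 + 4p ≤ 7`.
      have : ε * (4 - 20 * well u + (1 + 20 * z 0) * wellDeriv u * p (z 0) / w) +
          ε * (4 - (1 + 20 * z 0) * wellDeriv u / w) * p (z 0) = ε * (4 + 4 * p (z 0) - 20 * well u) := by
        ring
      rw [this]
      nlinarith [hpz.2]

/-! ### The cost of passing a column -/

theorem DetAlgorithm.answers_congr (A : DetAlgorithm) {f f' : Plane → ℝ} {n : ℕ}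
    (h : ∀ t < n, f (A.query (A.answers f t)) = f' (A.query (A.answers f t))) :
    ∀ t ≤ n, A.answers f t = A.answers f' t := by
  intro t
  induction t with
  | zero => intro _; rfl
  | succ t ih =>
    intro ht
    rw [DetAlgorithm.answers, DetAlgorithm.answers, ← ih (by omega), h t (by omega)]

/-- The test includes the current term, so the terms counted form an initial segment whose total is
still below `b`. -/
theorem sum_range_ite_partial_sum_lt_le {a : ℕ → ℝ} (ha : ∀ t, 0 ≤ a t) {b : ℝ} (hb : 0 ≤ b) (n : ℕ) :
    ∑ t ∈ Finset.range n, (if ∑ i ∈ Finset.range (t + 1), a i < b then a t else 0) ≤ b := by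
  induction n with
  | zero => simpa
  | succ n ih =>
    by_cases h : ∑ i ∈ Finset.range (n + 1), a i < b
    · refine le_trans (Finset.sum_le_sum fun t _ => ?_) h.le
      split_ifs
      · exact le_rfl
      · exact ha t
    · rw [Finset.sum_range_succ, if_neg h, add_zero]
      exact ih

/-- The oracle that reveals `F ξ` on the columns up to `s` and the background elsewhere. -/
noncomputable def truncatedOracle {Ξ : Type*} (F : Ξ → Plane → ℝ) (f₀ : Plane → ℝ)
    (col : Plane → ℕ) (s : ℕ) (ξ : Ξ) (z : Plane) : ℝ :=
  if col z ≤ s then F ξ z else f₀ z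

section

variable {Ξ : Type*} [Fintype Ξ] {F : Ξ → Plane → ℝ} {f₀ : Plane → ℝ} {col : Plane → ℕ}
  {Hit : Ξ → Plane → Prop}

open Classical in
/-- An algorithm that passes column `s` spends in the mean a constant amount of hitting probability
beyond that column. -/
theorem quarter_le_sum_hitBound (A : DetAlgorithm) (s : ℕ) {pre : Plane → ℝ}
    (hpre : ∀ z, 0 ≤ pre z) (hF : ∀ ξ z, ¬ Hit ξ z → F ξ z = f₀ z)
    (hH : ∀ (Z : Ξ → unitSquare) (P : Ξ → Prop),
      (∀ ξ ξ', truncatedOracle F f₀ col s ξ = truncatedOracle F f₀ col s ξ' →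
        Z ξ = Z ξ' ∧ (P ξ ↔ P ξ')) →
      ((Finset.univ.filter fun ξ => P ξ ∧ s < col (Z ξ) ∧ Hit ξ (Z ξ)).card : ℝ) ≤
        ∑ ξ, if P ξ then pre (Z ξ) else 0)
    (T : Ξ → ℕ)
    (hT : ∀ ξ, s < col (A.output (A.answers (F ξ) (T ξ))) ∧
      Hit ξ (A.output (A.answers (F ξ) (T ξ)))) :
    (Fintype.card Ξ : ℝ) / 4 ≤ ∑ ξ, ∑ t ∈ Finset.range (T ξ + 1),
      (pre (A.output (A.answers (F ξ) t)) + pre (A.query (A.answers (F ξ) t))) := by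
  set G := truncatedOracle F f₀ col s with hG
  set o : ℕ → Ξ → unitSquare := fun t ξ => A.output (A.answers (G ξ) t) with ho
  set q : ℕ → Ξ → unitSquare := fun t ξ => A.query (A.answers (G ξ) t) with hq
  set a : Ξ → ℕ → ℝ := fun ξ t => pre (o t ξ) + pre (q t ξ) with ha
  set W : Ξ → ℕ → ℝ := fun ξ t => ∑ i ∈ Finset.range (t + 1), a ξ i with hW
  have ha0 : ∀ ξ t, 0 ≤ a ξ t := fun ξ t => add_nonneg (hpre _) (hpre _)
  set n := Finset.univ.sup T + 1 with hn
  have hTn : ∀ ξ, T ξ < n := fun ξ => Nat.lt_succ_of_le (Finset.le_sup (Finset.mem_univ ξ))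
  set hitO : ℕ → Finset Ξ := fun t =>
    Finset.univ.filter fun ξ => W ξ t < 1 / 2 ∧ s < col (o t ξ) ∧ Hit ξ (o t ξ) with hhitO
  set hitQ : ℕ → Finset Ξ := fun t =>
    Finset.univ.filter fun ξ => W ξ t < 1 / 2 ∧ s < col (q t ξ) ∧ Hit ξ (q t ξ) with hhitQ
  set bad : Finset Ξ := (Finset.range n).biUnion fun t => hitO t ∪ hitQ t with hbad
  have hWc : ∀ t ξ ξ', G ξ = G ξ' → (W ξ t < 1 / 2 ↔ W ξ' t < 1 / 2) := by
    intro t ξ ξ' h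
    simp only [hW, ha, ho, hq, h]
  -- Union bound over times. The test `W ξ t < 1 / 2` is determined by the truncated oracle, so `hH`
  -- applies, and it caps the spending counted for each `ξ` at `1/2`.
  have hbadcard : (bad.card : ℝ) ≤ Fintype.card Ξ / 2 := by
    calc (bad.card : ℝ) ≤ ∑ t ∈ Finset.range n, ((hitO t ∪ hitQ t).card : ℝ) := by
          exact_mod_cast Finset.card_biUnion_le
      _ ≤ ∑ t ∈ Finset.range n, (((hitO t).card : ℝ) + (hitQ t).card) := by
          gcongr with t
          exact_mod_cast Finset.card_union_le _ _
      _ ≤ ∑ t ∈ Finset.range n, ((∑ ξ, if W ξ t < 1 / 2 then pre (o t ξ) else 0) +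
            ∑ ξ, if W ξ t < 1 / 2 then pre (q t ξ) else 0) := by
          gcongr with t
          · exact hH (o t) (fun ξ => W ξ t < 1 / 2)
              fun ξ ξ' h => ⟨by simp only [ho, h], hWc t ξ ξ' h⟩
          · exact hH (q t) (fun ξ => W ξ t < 1 / 2)
              fun ξ ξ' h => ⟨by simp only [hq, h], hWc t ξ ξ' h⟩
      _ = ∑ ξ, ∑ t ∈ Finset.range n, if W ξ t < 1 / 2 then a ξ t else 0 := by
          rw [Finset.sum_comm]
          refine Finset.sum_congr rfl fun t _ => ?_
          rw [← Finset.sum_add_distrib]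
          refine Finset.sum_congr rfl fun ξ _ => ?_
          split_ifs <;> simp [ha]
      _ ≤ ∑ _ξ : Ξ, (1 / 2 : ℝ) := Finset.sum_le_sum fun ξ _ =>
          sum_range_ite_partial_sum_lt_le (ha0 ξ) (by norm_num) n
      _ = Fintype.card Ξ / 2 := by simp; ring
  have hgood : ∀ ξ, ξ ∉ bad → 1 / 2 ≤ ∑ t ∈ Finset.range (T ξ + 1),
      (pre (A.output (A.answers (F ξ) t)) + pre (A.query (A.answers (F ξ) t))) := by
    intro ξ hξ
    -- Up to the first hit beyond column `s`, the runs on `F ξ` and on the truncated oracle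
    -- coincide. For `ξ ∉ bad` that hit can occur only once `1/2` has been spent.
    have hex : ∃ t, (s < col (A.output (A.answers (F ξ) t)) ∧ Hit ξ (A.output (A.answers (F ξ) t))) ∨
        (s < col (A.query (A.answers (F ξ) t)) ∧ Hit ξ (A.query (A.answers (F ξ) t))) :=
      ⟨T ξ, Or.inl (hT ξ)⟩
    obtain ⟨t₀, h₀, hlt⟩ := Nat.findX hex
    have ht₀ : t₀ ≤ T ξ := by
      by_contra hc
      exact hlt _ (not_le.mp hc) (Or.inl (hT ξ))
    have hans := A.answers_congr (f := F ξ) (f' := G ξ) (n := t₀) fun t ht => by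
      have := hlt t ht
      push Not at this
      rw [hG, truncatedOracle]
      split_ifs with hcol
      · rfl
      · exact hF _ _ (this.2 (not_le.mp hcol))
    have hWge : 1 / 2 ≤ W ξ t₀ := by
      by_contra hc
      refine hξ (Finset.mem_biUnion.mpr ⟨t₀, Finset.mem_range.mpr (lt_of_le_of_lt ht₀ (hTn ξ)), ?_⟩)
      rw [hans t₀ le_rfl] at h₀
      rw [Finset.mem_union, hhitO, hhitQ]
      simp only [Finset.mem_filter, Finset.mem_univ, true_and]
      exact h₀.imp (fun h => ⟨not_le.mp hc, h⟩) (fun h => ⟨not_le.mp hc, h⟩)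
    refine hWge.trans ?_
    calc W ξ t₀ = ∑ t ∈ Finset.range (t₀ + 1),
          (pre (A.output (A.answers (F ξ) t)) + pre (A.query (A.answers (F ξ) t))) := by
          refine Finset.sum_congr rfl fun t ht => ?_
          rw [hans t (Nat.lt_succ_iff.mp (Finset.mem_range.mp ht))]
      _ ≤ _ := Finset.sum_le_sum_of_subset_of_nonneg
          (Finset.range_subset_range.mpr (by omega)) fun _ _ _ => add_nonneg (hpre _) (hpre _)
  have hcompl : (Fintype.card Ξ : ℝ) / 2 ≤ (badᶜ.card : ℝ) := by
    rw [Finset.card_compl, Nat.cast_sub (Finset.card_le_univ _)]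
    linarith
  calc (Fintype.card Ξ : ℝ) / 4 ≤ badᶜ.card * (1 / 2) := by linarith
    _ = ∑ _ξ ∈ badᶜ, (1 / 2 : ℝ) := by simp
    _ ≤ ∑ ξ ∈ badᶜ, ∑ t ∈ Finset.range (T ξ + 1),
        (pre (A.output (A.answers (F ξ) t)) + pre (A.query (A.answers (F ξ) t))) :=
        Finset.sum_le_sum fun ξ hξ => hgood ξ (Finset.mem_compl.mp hξ)
    _ ≤ _ := Finset.sum_le_sum_of_subset_of_nonneg (Finset.subset_univ _) fun _ _ _ =>
        Finset.sum_nonneg fun _ _ => add_nonneg (hpre _) (hpre _)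

end

/-! ### Resampling one coordinate -/

/-- Exchanging `v` with `ξ i` is an involution on the pairs `(ξ, v)`. -/
theorem sum_sum_update {ι κ : Type*} [Fintype ι] [DecidableEq ι] [Fintype κ] (i : ι)
    (G : (ι → κ) → ℝ) :
    ∑ ξ, ∑ v, G (Function.update ξ i v) = Fintype.card κ * ∑ ξ, G ξ := by
  have hinv : Function.Involutive
      (fun x : (ι → κ) × κ => ((Function.update x.1 i x.2, x.1 i) : (ι → κ) × κ)) := by
    rintro ⟨ξ, v⟩
    simp
  have hsum : ∑ x : (ι → κ) × κ, G (Function.update x.1 i x.2) = ∑ x : (ι → κ) × κ, G x.1 :=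
    Equiv.sum_comp (hinv.toPerm _) (fun x : (ι → κ) × κ => G x.1)
  rw [← Fintype.sum_prod_type' (f := fun ξ v => G (Function.update ξ i v)), hsum,
    Fintype.sum_prod_type]
  simp [Finset.mul_sum]

open Classical in
/-- A coordinate on which neither the event nor the point depends can be resampled. -/
theorem card_hit_le_of_update {ι κ : Type*} [Fintype ι] [DecidableEq ι] [Fintype κ] [Nonempty κ]
    {X : Type*} {Hit : (ι → κ) → X → Prop} (i : ι) {c : ℝ} {Z : (ι → κ) → X} {P : (ι → κ) → Prop}
    (hZ : ∀ ξ v, Z (Function.update ξ i v) = Z ξ) (hP : ∀ ξ v, P (Function.update ξ i v) ↔ P ξ)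
    (hc : ∀ ξ, P ξ → ((Finset.univ.filter fun v => Hit (Function.update ξ i v) (Z ξ)).card : ℝ) ≤
      c * Fintype.card κ) :
    ((Finset.univ.filter fun ξ => P ξ ∧ Hit ξ (Z ξ)).card : ℝ) ≤
      c * (Finset.univ.filter P).card := by
  have hκ : (0 : ℝ) < Fintype.card κ := by exact_mod_cast Fintype.card_pos
  refine le_of_mul_le_mul_left ?_ hκ
  have h1 : ((Finset.univ.filter fun ξ => P ξ ∧ Hit ξ (Z ξ)).card : ℝ) =
      ∑ ξ, if P ξ ∧ Hit ξ (Z ξ) then 1 else 0 := by simp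
  have h2 : ((Finset.univ.filter P).card : ℝ) = ∑ ξ, if P ξ then 1 else 0 := by simp
  rw [h1, ← sum_sum_update i, h2, Finset.mul_sum, Finset.mul_sum]
  refine Finset.sum_le_sum fun ξ _ => ?_
  simp only [hZ, hP]
  by_cases hp : P ξ
  · simpa [hp, mul_comm] using hc ξ hp
  · simp [hp]

open Classical in
theorem card_fin_abs_sub_le {R : ℕ} {α β r : ℝ} (hβ : 0 < β) (hr : 0 ≤ r) :
    ((Finset.univ.filter fun v : Fin R => |α - β * (v : ℕ)| ≤ r).card : ℝ) ≤ 2 * r / β + 1 := by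
  set S := Finset.univ.filter fun v : Fin R => |α - β * (v : ℕ)| ≤ r with hS
  rcases S.eq_empty_or_nonempty with h | h
  · rw [h]; simp; positivity
  set m := (S.min' h : ℕ) with hm
  have hmS := S.min'_mem h
  have hsub : S.image (fun v : Fin R => (v : ℕ)) ⊆ Finset.Icc m (m + ⌊2 * r / β⌋₊) := by
    intro x hx
    obtain ⟨v, hv, rfl⟩ := Finset.mem_image.mp hx
    have hmv : m ≤ (v : ℕ) := S.min'_le v hv
    refine Finset.mem_Icc.mpr ⟨hmv, ?_⟩
    have h1 := abs_le.mp (Finset.mem_filter.mp hv).2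
    have h2 := abs_le.mp (Finset.mem_filter.mp hmS).2
    have h3 : (((v : ℕ) - m : ℕ) : ℝ) ≤ 2 * r / β := by
      rw [Nat.cast_sub hmv, le_div_iff₀ hβ]
      linarith [h1.1, h2.2]
    have := Nat.le_floor h3
    omega
  have hcard : S.card ≤ ⌊2 * r / β⌋₊ + 1 := by
    rw [← Finset.card_image_of_injective S Fin.val_injective]
    refine (Finset.card_le_card hsub).trans ?_
    rw [Nat.card_Icc]
    omega
  calc (S.card : ℝ) ≤ (⌊2 * r / β⌋₊ + 1 : ℕ) := by exact_mod_cast hcard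
    _ ≤ 2 * r / β + 1 := by
      push_cast
      gcongr
      exact Nat.floor_le (by positivity)

/-! ### The random curve -/

theorem tentSum_eq_zero_or {n : ℕ} (θ : Fin n → ℝ) (v : ℝ) :
    ∑ m : Fin n, θ m * tent (v - (m : ℕ)) = 0 ∨
      ∃ m₀, ∑ m : Fin n, θ m * tent (v - (m : ℕ)) = θ m₀ * tent (v - (m₀ : ℕ)) := by
  by_cases h : ∃ m₀ : Fin n, tent (v - (m₀ : ℕ)) ≠ 0
  · obtain ⟨m₀, hm₀⟩ := h
    refine Or.inr ⟨m₀, Finset.sum_eq_single m₀ (fun m _ hm => ?_) (by simp)⟩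
    by_contra hc
    have h1 := floor_eq_of_tent_ne_zero (right_ne_zero_of_mul hc)
    rw [floor_eq_of_tent_ne_zero hm₀] at h1
    exact hm (Fin.ext (by exact_mod_cast h1.symm))
  · push Not at h
    exact Or.inl (Finset.sum_eq_zero fun m _ => by rw [h m, mul_zero])

theorem tentSum_mem_Icc {n : ℕ} {θ : Fin n → ℝ} (hθ : ∀ m, θ m ∈ Set.Icc (0 : ℝ) 1) (v : ℝ) :
    ∑ m : Fin n, θ m * tent (v - (m : ℕ)) ∈ Set.Icc (0 : ℝ) 1 := by
  rcases tentSum_eq_zero_or θ v with h | ⟨m, h⟩ <;> rw [h]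
  · simp
  · exact ⟨mul_nonneg (hθ m).1 (tent_nonneg _),
      mul_le_one₀ (hθ m).2 (tent_nonneg _) (tent_le_one _)⟩

/-- At most one tent is active at `v`, and the sum at `v'` is at least that tent's term. So the
Lipschitz constant of a single tent suffices. -/
theorem abs_tentSum_sub_le {n : ℕ} {θ : Fin n → ℝ} (hθ : ∀ m, θ m ∈ Set.Icc (0 : ℝ) 1) (v v' : ℝ) :
    |∑ m : Fin n, θ m * tent (v - (m : ℕ)) - ∑ m : Fin n, θ m * tent (v' - (m : ℕ))| ≤
      2 * |v - v'| := by
  have key : ∀ v v' : ℝ, ∑ m : Fin n, θ m * tent (v - (m : ℕ)) -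
      ∑ m : Fin n, θ m * tent (v' - (m : ℕ)) ≤ 2 * |v - v'| := by
    intro v v'
    rcases tentSum_eq_zero_or θ v with h | ⟨m₀, h⟩
    · rw [h]
      linarith [(tentSum_mem_Icc hθ v').1, abs_nonneg (v - v')]
    · have h1 : θ m₀ * tent (v' - (m₀ : ℕ)) ≤ ∑ m : Fin n, θ m * tent (v' - (m : ℕ)) :=
        Finset.single_le_sum (f := fun m : Fin n => θ m * tent (v' - (m : ℕ)))
          (fun m _ => mul_nonneg (hθ m).1 (tent_nonneg _)) (Finset.mem_univ m₀)
      have h2 := abs_tent_sub_le (v - (m₀ : ℕ)) (v' - (m₀ : ℕ))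
      rw [sub_sub_sub_cancel_right] at h2
      have h3 := le_abs_self (tent (v - (m₀ : ℕ)) - tent (v' - (m₀ : ℕ)))
      have h4 : θ m₀ * (tent (v - (m₀ : ℕ)) - tent (v' - (m₀ : ℕ))) ≤ 1 * (2 * |v - v'|) :=
        (mul_le_mul_of_nonneg_left (h3.trans h2) (hθ m₀).1).trans
          (mul_le_mul_of_nonneg_right (hθ m₀).2 (by positivity))
      rw [h]
      linarith
  rw [abs_le]
  constructor
  · have := key v' v
    rw [abs_sub_comm] at this
    linarith
  · exact key v v'

section

variable {n R : ℕ}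

/-- A random curve: its slope is a sum of independent tents over the dyadic blocks, those of
length `2 ^ j * w` having amplitude at most `a j`. -/
noncomputable def curve (a : ℕ → ℝ) (w : ℝ) (ξ : Fin n × Fin n → Fin R) (x : ℝ) : ℝ :=
  x / 4 + ∑ i, a (i.1 : ℕ) * (2 ^ (i.1 : ℕ) * w) * ((ξ i : ℕ) / R) *
    ramp (x / (2 ^ (i.1 : ℕ) * w) - (i.2 : ℕ))

/-- The derivative of `curve`. -/
noncomputable def curveSlope (a : ℕ → ℝ) (w : ℝ) (ξ : Fin n × Fin n → Fin R) (x : ℝ) : ℝ :=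
  1 / 4 + ∑ j : Fin n, a j * ∑ m : Fin n, ((ξ (j, m) : ℕ) / R : ℝ) *
    tent (x / (2 ^ (j : ℕ) * w) - (m : ℕ))

variable {a : ℕ → ℝ} {w : ℝ} (ξ : Fin n × Fin n → Fin R)

theorem hasDerivAt_curve (hw : 0 < w) (x : ℝ) :
    HasDerivAt (curve a w ξ) (curveSlope a w ξ x) x := by
  have hterm : ∀ i : Fin n × Fin n, HasDerivAt
      (fun x : ℝ => a (i.1 : ℕ) * (2 ^ (i.1 : ℕ) * w) * ((ξ i : ℕ) / R) *
        ramp (x / (2 ^ (i.1 : ℕ) * w) - (i.2 : ℕ)))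
      (a i.1 * (((ξ i : ℕ) / R : ℝ) * tent (x / (2 ^ (i.1 : ℕ) * w) - (i.2 : ℕ)))) x := by
    intro i
    have hin : HasDerivAt (fun x : ℝ => x / (2 ^ (i.1 : ℕ) * w) - (i.2 : ℕ))
        (1 / (2 ^ (i.1 : ℕ) * w)) x := ((hasDerivAt_id x).div_const _).sub_const _
    refine (((hasDerivAt_ramp _).comp x hin).const_mul
      (a (i.1 : ℕ) * (2 ^ (i.1 : ℕ) * w) * ((ξ i : ℕ) / R))).congr_deriv ?_
    field_simp
  have := ((hasDerivAt_id x).div_const 4).add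
    (HasDerivAt.fun_sum (u := Finset.univ) fun i _ => hterm i)
  refine HasDerivAt.congr_deriv (f := curve a w ξ) this ?_
  rw [curveSlope, Fintype.sum_prod_type]
  simp only [Finset.mul_sum]

theorem fin_div_mem_Icc (v : Fin R) : ((v : ℕ) / R : ℝ) ∈ Set.Icc (0 : ℝ) 1 :=
  ⟨by positivity, div_le_one_of_le₀ (by exact_mod_cast v.2.le) (by positivity)⟩

theorem curve_zero : curve a w ξ 0 = 0 := by
  unfold curve
  rw [zero_div, zero_add]
  refine Finset.sum_eq_zero fun i _ => ?_
  rw [ramp_of_nonpos (by simp), mul_zero]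

theorem curveSlope_mem_Icc (ha : ∀ j, 0 ≤ a j) (hsum : ∑ j ∈ Finset.range n, a j ≤ 1 / 2) (x : ℝ) :
    curveSlope a w ξ x ∈ Set.Icc (1 / 4 : ℝ) (3 / 4) := by
  have h := fun j : Fin n => tentSum_mem_Icc (fun m => fin_div_mem_Icc (ξ (j, m)))
    (x / (2 ^ (j : ℕ) * w))
  unfold curveSlope
  constructor
  · exact le_add_of_nonneg_right (Finset.sum_nonneg fun j _ => mul_nonneg (ha j) (h j).1)
  · have : ∑ j : Fin n, a j * ∑ m : Fin n, ((ξ (j, m) : ℕ) / R : ℝ) *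
        tent (x / (2 ^ (j : ℕ) * w) - (m : ℕ)) ≤ ∑ j : Fin n, a j :=
      Finset.sum_le_sum fun j _ => mul_le_of_le_one_right (ha j) (h j).2
    rw [Fin.sum_univ_eq_sum_range] at this
    linarith

/-- Scale `j` contributes at most `2 * a j / (2 ^ j * w) ≤ 2 * a j / w`; total amplitude `1/2`
leaves exactly `1/w`. -/
theorem abs_curveSlope_sub_le (hw : 0 < w) (ha : ∀ j, 0 ≤ a j)
    (hsum : ∑ j ∈ Finset.range n, a j ≤ 1 / 2) (x x' : ℝ) :
    |curveSlope a w ξ x - curveSlope a w ξ x'| ≤ |x - x'| / w := by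
  unfold curveSlope
  rw [add_sub_add_left_eq_sub, ← Finset.sum_sub_distrib]
  refine (Finset.abs_sum_le_sum_abs _ _).trans ?_
  have hj : ∀ j : Fin n, |a j * ∑ m : Fin n, ((ξ (j, m) : ℕ) / R : ℝ) *
        tent (x / (2 ^ (j : ℕ) * w) - (m : ℕ)) - a j * ∑ m : Fin n, ((ξ (j, m) : ℕ) / R : ℝ) *
        tent (x' / (2 ^ (j : ℕ) * w) - (m : ℕ))| ≤ a j * (2 * (|x - x'| / w)) := by
    intro j
    rw [← mul_sub, abs_mul, abs_of_nonneg (ha j)]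
    refine mul_le_mul_of_nonneg_left ?_ (ha j)
    refine (abs_tentSum_sub_le (fun m => fin_div_mem_Icc (ξ (j, m))) _ _).trans ?_
    rw [← sub_div, abs_div, abs_of_pos (by positivity : (0:ℝ) < 2 ^ (j : ℕ) * w)]
    gcongr
    exact le_mul_of_one_le_left hw.le (one_le_pow₀ one_le_two)
  refine (Finset.sum_le_sum fun j _ => hj j).trans ?_
  rw [← Finset.sum_mul, Fin.sum_univ_eq_sum_range]
  have : 0 ≤ |x - x'| / w := by positivity
  nlinarith

/-- A block starting after `x` has no influence at `x`. -/
theorem curve_update_of_le (hw : 0 < w) (i : Fin n × Fin n) (v : Fin R) {x : ℝ}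
    (hx : x / w ≤ (i.2 : ℕ) * 2 ^ (i.1 : ℕ)) :
    curve a w (Function.update ξ i v) x = curve a w ξ x := by
  unfold curve
  congr 1
  refine Finset.sum_congr rfl fun i' _ => ?_
  by_cases h : i' = i
  · subst h
    rw [ramp_of_nonpos, mul_zero, mul_zero]
    rw [sub_nonpos, mul_comm, ← div_div, div_le_iff₀ (by positivity)]
    exact hx
  · rw [Function.update_of_ne h]

/-- A block ending before `x` contributes linearly at `x`. -/
theorem exists_curve_update_eq (hw : 0 < w) (i : Fin n × Fin n) {x : ℝ}
    (hx : ((i.2 : ℕ) + 1) * 2 ^ (i.1 : ℕ) ≤ x / w) :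
    ∃ α : ℝ, ∀ v : Fin R, curve a w (Function.update ξ i v) x =
      α + a i.1 * 2 ^ (i.1 : ℕ) * w / (2 * R) * (v : ℕ) := by
  refine ⟨x / 4 + ∑ i' ∈ Finset.univ.erase i, a (i'.1 : ℕ) * (2 ^ (i'.1 : ℕ) * w) *
    ((ξ i' : ℕ) / R) * ramp (x / (2 ^ (i'.1 : ℕ) * w) - (i'.2 : ℕ)), fun v => ?_⟩
  unfold curve
  rw [← Finset.sum_erase_add _ _ (Finset.mem_univ i), Function.update_self, ramp_of_one_le,
    Finset.sum_congr rfl fun i' hi' => by rw [Function.update_of_ne (Finset.ne_of_mem_erase hi')]]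
  · ring
  · rw [mul_comm (2 ^ _) w, ← div_div, le_sub_iff_add_le, le_div_iff₀ (by positivity), add_comm]
    exact hx

end

/-! ### Unpredictability of the curve -/

/-- With `j = log₂ k - 1`, two blocks of length `2 ^ j` fit into `k`, so the block starting at the
first multiple of `2 ^ j` after `s` ends by `s + k`. -/
theorem exists_dyadic_block {s k : ℕ} (hk : 2 ≤ k) :
    ∃ j m : ℕ, s + 1 ≤ m * 2 ^ j ∧ (m + 1) * 2 ^ j ≤ s + k ∧ k ≤ 4 * 2 ^ j ∧ 2 ^ j ≤ k := by
  obtain ⟨j, hj⟩ : ∃ j, Nat.log 2 k = j + 1 :=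
    ⟨Nat.log 2 k - 1, by have := Nat.log_pos one_lt_two hk; omega⟩
  have h1 : 2 ^ (j + 1) ≤ k := hj ▸ Nat.pow_log_le_self 2 (by omega)
  have h2 : k < 2 ^ (j + 1 + 1) := hj ▸ Nat.lt_pow_succ_log_self one_lt_two k
  have h3 := Nat.div_add_mod s (2 ^ j)
  have h4 := Nat.mod_lt s (Nat.two_pow_pos j)
  have h5 := Nat.two_pow_pos j
  rw [pow_succ] at h1
  rw [pow_succ, pow_succ] at h2
  refine ⟨j, s / 2 ^ j + 1, ?_, ?_, by omega, by omega⟩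
  · rw [add_mul, mul_comm]; omega
  · rw [add_mul, add_mul, mul_comm]; omega

/-- The column of width `w` containing a point. -/
noncomputable def column (w : ℝ) (z : Plane) : ℕ := ⌊z 0 / w⌋₊

/-- The point lies vertically within `w` of the graph of `g`. -/
def NearCurve (w : ℝ) (g : ℝ → ℝ) (z : Plane) : Prop := |z 1 - g (z 0)| ≤ w

/-- A bound, up to the constant `C`, for the probability that a point is on the curve given the
curve up to column `s`. -/
noncomputable def hitBound (C : ℝ) (h : ℕ → ℝ) (w : ℝ) (s : ℕ) (z : Plane) : ℝ :=
  if s < column w z then C * (1 / (((column w z - s : ℕ) : ℝ) * h (column w z - s))) else 0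

theorem hitBound_nonneg {C : ℝ} {h : ℕ → ℝ} (hC : 0 ≤ C) (hh : ∀ k, 1 ≤ k → 0 < h k) (w : ℝ) (s : ℕ)
    (z : Plane) : 0 ≤ hitBound C h w s z := by
  unfold hitBound
  split_ifs with hs
  · have := hh (column w z - s) (by omega)
    positivity
  · exact le_rfl

/-- For a fixed point, different `s` give different distances `k`, so each term of `sumRecip` is
used at most once. -/
theorem sum_hitBound_le {C : ℝ} {h : ℕ → ℝ} (hC : 0 ≤ C) (hh : ∀ k, 1 ≤ k → 0 < h k) {w : ℝ} {N : ℕ}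
    {z : Plane} (hz : column w z ≤ N) :
    ∑ s ∈ Finset.range N, hitBound C h w s z ≤ C * sumRecip h N := by
  unfold hitBound sumRecip
  generalize column w z = K at *
  rw [← Finset.sum_filter, Finset.mul_sum]
  have hinj : Set.InjOn (fun s => K - s) ((Finset.range N).filter (· < K) : Finset ℕ) := by
    intro s hs s' hs' e
    simp only [Finset.coe_filter, Finset.mem_range, Set.mem_ofPred_eq] at hs hs' e
    omega
  rw [← Finset.sum_image (f := fun k : ℕ => C * (1 / ((k : ℝ) * h k))) hinj]
  refine Finset.sum_le_sum_of_subset_of_nonneg ?_ fun k hk _ => ?_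
  · intro k hk
    simp only [Finset.mem_image, Finset.mem_filter, Finset.mem_range] at hk
    obtain ⟨s, hs, rfl⟩ := hk
    exact Finset.mem_Icc.mpr ⟨by omega, by omega⟩
  · have := hh k (Finset.mem_Icc.mp hk).1
    positivity

open Classical in
/-- The curve is unpredictable. -/
theorem card_hit_le_sum_hitBound {h : ℕ → ℝ} {c w : ℝ} {N R : ℕ} {f₀ : Plane → ℝ}
    {V : (ℝ → ℝ) → Plane → ℝ}
    (hV : ∀ g g' z, g (z 0) = g' (z 0) → V g z = V g' z)
    (hh : ∀ k, 1 ≤ k → 0 < h k) (hanti : AntitoneOn h (Set.Ici 1)) (hc : 0 < c) (hw : 0 < w)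
    (hN : N = ⌊1 / w⌋₊) (hR : 0 < R) (hRN : c * h 1 * N ≤ R) (s : ℕ)
    (Z : (Fin (N + 1) × Fin (N + 1) → Fin R) → unitSquare)
    (P : (Fin (N + 1) × Fin (N + 1) → Fin R) → Prop)
    (hZP : ∀ ξ ξ', truncatedOracle (fun ξ => V (curve (fun j => c * h (2 ^ j)) w ξ)) f₀
        (column w) s ξ = truncatedOracle (fun ξ => V (curve (fun j => c * h (2 ^ j)) w ξ)) f₀
        (column w) s ξ' → Z ξ = Z ξ' ∧ (P ξ ↔ P ξ')) :
    ((Finset.univ.filter fun ξ => P ξ ∧ s < column w (Z ξ) ∧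
      NearCurve w (curve (fun j => c * h (2 ^ j)) w ξ) (Z ξ)).card : ℝ) ≤
      ∑ ξ, if P ξ then hitBound (17 / c + h 1) h w s (Z ξ) else 0 := by
  have : Nonempty (Fin R) := ⟨⟨0, hR⟩⟩
  set a : ℕ → ℝ := fun j => c * h (2 ^ j) with ha
  have hh1 := hh 1 le_rfl
  have hC : 0 ≤ 17 / c + h 1 := by positivity
  have hcolN : ∀ z : unitSquare, column w z ≤ N := by
    intro z
    rw [hN]
    exact Nat.floor_le_floor (by have := (z.2 0).2; gcongr)
  have hk : ∀ k, 1 ≤ k → s + k ≤ N →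
      ((Finset.univ.filter fun ξ => (P ξ ∧ column w (Z ξ) = s + k) ∧
        NearCurve w (curve a w ξ) (Z ξ)).card : ℝ) ≤
      ((17 / c + h 1) * (1 / ((k : ℝ) * h k))) *
        (Finset.univ.filter fun ξ => P ξ ∧ column w (Z ξ) = s + k).card := by
    intro k hk1 hkN
    have hhk := hh k hk1
    rcases eq_or_lt_of_le hk1 with rfl | hk2
    · have h1 : (1 : ℝ) ≤ (17 / c + h 1) * (1 / ((1 : ℕ) * h 1)) := by
        rw [Nat.cast_one, one_mul, mul_one_div, le_div_iff₀ hh1]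
        have : 0 < 17 / c := by positivity
        linarith
      refine le_trans ?_ (le_mul_of_one_le_left (by positivity) h1)
      exact_mod_cast Finset.card_le_card (Finset.monotone_filter_right _ fun _ _ hξ => And.left hξ)
    obtain ⟨j, m, hm1, hm2, hj1, hj2⟩ := exists_dyadic_block (s := s) hk2
    have hjN : j < N + 1 := by have := j.lt_two_pow_self; omega
    have hmN : m < N + 1 := by
      have : m * 1 ≤ m * 2 ^ j := Nat.mul_le_mul_left m Nat.one_le_two_pow
      have : m * 2 ^ j ≤ (m + 1) * 2 ^ j := Nat.mul_le_mul_right _ (by omega)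
      omega
    obtain ⟨i, hi1, hi2⟩ : ∃ i : Fin (N + 1) × Fin (N + 1), (i.1 : ℕ) = j ∧ (i.2 : ℕ) = m :=
      ⟨(⟨j, hjN⟩, ⟨m, hmN⟩), rfl, rfl⟩
    -- The block starts at column `s + 1` or later, so the truncated oracle does not see its
    -- coefficient.
    have hinv : ∀ ξ v, Z (Function.update ξ i v) = Z ξ ∧ (P (Function.update ξ i v) ↔ P ξ) := by
      intro ξ v
      refine hZP _ _ ?_
      funext z
      unfold truncatedOracle
      split_ifs with hz
      · refine hV _ _ _ (curve_update_of_le ξ hw i v ?_)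
        have h1 : z 0 / w < ((s + 1 : ℕ) : ℝ) := Nat.lt_of_floor_lt (Nat.lt_succ_of_le hz)
        have h2 : ((s + 1 : ℕ) : ℝ) ≤ ((m * 2 ^ j : ℕ) : ℝ) := by exact_mod_cast hm1
        push_cast at h1 h2
        rw [hi1, hi2]
        linarith
      · rfl
    -- The block ends before the point, so the height there is affine in the coefficient, with
    -- spread about `a j * 2 ^ j * w / 2`, while a hit needs a window of length `2 * w`.
    have hcount : ∀ ξ, P ξ ∧ column w (Z ξ) = s + k → ((Finset.univ.filter fun v =>
        NearCurve w (curve a w (Function.update ξ i v)) (Z ξ)).card : ℝ) ≤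
        ((17 / c + h 1) * (1 / ((k : ℝ) * h k))) * Fintype.card (Fin R) := by
      intro ξ hξ
      have hx : ((m : ℝ) + 1) * 2 ^ j ≤ (Z ξ : Plane) 0 / w := by
        have h1 : ((s + k : ℕ) : ℝ) ≤ (Z ξ : Plane) 0 / w := by
          rw [← hξ.2]
          exact Nat.floor_le (div_nonneg ((Z ξ).2 0).1 hw.le)
        have h2 : (((m + 1) * 2 ^ j : ℕ) : ℝ) ≤ ((s + k : ℕ) : ℝ) := by exact_mod_cast hm2
        push_cast at h1 h2
        linarith
      obtain ⟨α, hα⟩ := exists_curve_update_eq (a := a) ξ hw i (by rwa [hi1, hi2])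
      rw [hi1] at hα
      have hRr : (0 : ℝ) < R := by exact_mod_cast hR
      have h2j : (0 : ℝ) < 2 ^ j := by positivity
      have hhj := hh (2 ^ j) Nat.one_le_two_pow
      have hβ : 0 < a j * 2 ^ j * w / (2 * R) := by simp only [ha]; positivity
      have hcard := card_fin_abs_sub_le (R := R) (α := (Z ξ : Plane) 1 - α) hβ hw.le
      have hset : (Finset.univ.filter fun v : Fin R =>
          NearCurve w (curve a w (Function.update ξ i v)) (Z ξ)) =
          Finset.univ.filter fun v : Fin R =>
            |(Z ξ : Plane) 1 - α - a j * 2 ^ j * w / (2 * R) * (v : ℕ)| ≤ w := by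
        refine Finset.filter_congr fun v _ => ?_
        unfold NearCurve
        rw [hα v, sub_sub]
      rw [hset]
      refine hcard.trans ?_
      have hkr : (0 : ℝ) < k := by exact_mod_cast hk1
      have hckh : 0 < c * (k * h k) := by positivity
      have hmono : h k ≤ h (2 ^ j) :=
        hanti (Set.mem_Ici.mpr Nat.one_le_two_pow) (Set.mem_Ici.mpr hk1) hj2
      have hmono1 : h k ≤ h 1 := hanti (Set.mem_Ici.mpr le_rfl) (Set.mem_Ici.mpr hk1) hk1
      have hkj : (k : ℝ) ≤ 4 * 2 ^ j := by exact_mod_cast hj1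
      have hkN' : (k : ℝ) ≤ N := by exact_mod_cast (by omega : k ≤ N)
      have e1 : 2 * w / (a j * 2 ^ j * w / (2 * R)) = 4 * R / (c * (2 ^ j * h (2 ^ j))) := by
        simp only [ha]
        field_simp
        norm_num
      have e2 : 4 * R / (c * (2 ^ j * h (2 ^ j))) ≤ 16 * R / (c * (k * h k)) := by
        rw [div_le_div_iff₀ (by positivity) hckh]
        have : (k : ℝ) * h k ≤ 4 * 2 ^ j * h (2 ^ j) := by gcongr
        have := mul_le_mul_of_nonneg_left this (by positivity : (0:ℝ) ≤ 4 * R * c)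
        linarith
      -- The fineness of the grid `R` absorbs the rounding term `+1` of the count.
      have e3 : 1 ≤ R / (c * (k * h k)) := by
        rw [one_le_div hckh]
        refine le_trans ?_ hRN
        rw [mul_assoc c (h 1), mul_comm (h 1)]
        gcongr
      have e4 : 17 * R / (c * (k * h k)) ≤ (17 / c + h 1) * (1 / (k * h k)) * R := by
        have : 17 * R / (c * (k * h k)) = (17 / c) * (1 / (k * h k)) * R := by field_simp
        rw [this]
        gcongr
        linarith
      have e5 : 16 * R / (c * (k * h k)) + R / (c * (k * h k)) = 17 * R / (c * (k * h k)) := by ring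
      rw [Fintype.card_fin, e1]
      linarith
    have hres := card_hit_le_of_update (c := (17 / c + h 1) * (1 / ((k : ℝ) * h k)))
      (Hit := fun ξ (z : unitSquare) => NearCurve w (curve a w ξ) z)
      (P := fun ξ => P ξ ∧ column w (Z ξ) = s + k) i (fun ξ v => (hinv ξ v).1)
      (fun ξ v => by rw [(hinv ξ v).1, (hinv ξ v).2])
      fun ξ hξ => by convert hcount ξ hξ using 4
    convert hres using 5
  have hmaps : ∀ ξ ∈ Finset.univ.filter fun ξ => P ξ ∧ s < column w (Z ξ),
      column w (Z ξ) - s ∈ Finset.Icc 1 (N - s) := by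
    intro ξ hξ
    have h1 := (Finset.mem_filter.mp hξ).2.2
    have h2 := hcolN (Z ξ)
    exact Finset.mem_Icc.mpr ⟨by omega, by omega⟩
  have hmaps' : ∀ ξ ∈ Finset.univ.filter fun ξ => P ξ ∧ s < column w (Z ξ) ∧
      NearCurve w (curve a w ξ) (Z ξ),
      column w (Z ξ) - s ∈ Finset.Icc 1 (N - s) := by
    intro ξ hξ
    have h1 := (Finset.mem_filter.mp hξ).2
    exact hmaps ξ (Finset.mem_filter.mpr ⟨Finset.mem_univ _, h1.1, h1.2.1⟩)
  have hrhs : (∑ ξ, if P ξ then hitBound (17 / c + h 1) h w s (Z ξ) else 0) =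
      ∑ ξ ∈ Finset.univ.filter fun ξ => P ξ ∧ s < column w (Z ξ),
        (17 / c + h 1) * (1 / (((column w (Z ξ) - s : ℕ) : ℝ) * h (column w (Z ξ) - s))) := by
    rw [Finset.sum_filter]
    refine Finset.sum_congr rfl fun ξ _ => ?_
    unfold hitBound
    by_cases h1 : P ξ <;> by_cases h2 : s < column w (Z ξ) <;> simp [h1, h2]
  rw [hrhs, Finset.card_eq_sum_card_fiberwise hmaps', ← Finset.sum_fiberwise_of_maps_to hmaps,
    Nat.cast_sum]
  refine Finset.sum_le_sum fun k hkm => ?_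
  rw [Finset.mem_Icc] at hkm
  refine le_trans (le_of_eq ?_) ((hk k hkm.1 (by omega)).trans (le_of_eq ?_))
  · congr 2
    ext ξ
    simp only [Finset.mem_filter, Finset.mem_univ, true_and]
    constructor
    · rintro ⟨⟨h1, h2, h3⟩, h4⟩
      exact ⟨⟨h1, by omega⟩, h3⟩
    · rintro ⟨⟨h1, h2⟩, h3⟩
      exact ⟨⟨h1, by omega, h3⟩, by omega⟩
  · rw [Finset.filter_filter, Finset.sum_congr rfl (g := fun _ =>
      (17 / c + h 1) * (1 / ((k : ℝ) * h k))), Finset.sum_const, nsmul_eq_mul, mul_comm]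
    · congr 3
      ext ξ
      simp only [Finset.mem_filter, Finset.mem_univ, true_and]
      constructor
      · rintro ⟨h1, h2⟩
        exact ⟨⟨h1, by omega⟩, by omega⟩
      · rintro ⟨⟨h1, h2⟩, h3⟩
        exact ⟨h1, by omega⟩
    · intro ξ hξ
      rw [(Finset.mem_filter.mp hξ).2.2]

/-! ### From randomized to deterministic algorithms -/

theorem DetAlgorithm.queries_eq_top_or (A : DetAlgorithm) (f : Plane → ℝ) (ε : ℝ) :
    A.queries f ε = ⊤ ∨
      ∃ T : ℕ, A.queries f ε = T ∧ IsStationaryPoint f ε (A.output (A.answers f T)) := by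
  classical
  by_cases hex : ∃ t, IsStationaryPoint f ε (A.output (A.answers f t))
  · refine Or.inr ⟨Nat.find hex, le_antisymm ?_ ?_, Nat.find_spec hex⟩
    · exact iInf₂_le (f := fun (t : ℕ) (_ : IsStationaryPoint f ε (A.output (A.answers f t))) =>
        (t : ℝ≥0∞)) (Nat.find hex) (Nat.find_spec hex)
    · exact le_iInf₂ fun t ht => by exact_mod_cast Nat.find_min' hex ht
  · push Not at hex
    exact Or.inl (by simp [DetAlgorithm.queries, hex])

/-- The averaging principle: a bound for deterministic algorithms on a random function is a bound
for randomized algorithms. -/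
theorem le_queryComplexityRand {ε : ℝ} {Ξ : Type*} [Fintype Ξ] [Nonempty Ξ] {F : Ξ → Plane → ℝ}
    (hF : ∀ ξ, IsSmooth (F ξ)) {b : ℝ≥0∞}
    (hb : ∀ A : DetAlgorithm, b * Fintype.card Ξ ≤ ∑ ξ, A.queries (F ξ) ε) :
    b ≤ queryComplexityRand.{u} ε := by
  refine le_iInf fun A => ?_
  let := A.mΩ
  have := A.isProb
  have h1 : b * Fintype.card Ξ ≤
      (⨆ (f : Plane → ℝ) (_ : IsSmooth f), A.expectedQueries f) * Fintype.card Ξ := by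
    calc b * Fintype.card Ξ = ∫⁻ _, b * Fintype.card Ξ ∂A.μ := by simp
      _ ≤ ∫⁻ ω, ∑ ξ, (A.alg ω).queries (F ξ) ε ∂A.μ :=
          MeasureTheory.lintegral_mono fun ω => hb (A.alg ω)
      _ = ∑ ξ, A.expectedQueries (F ξ) :=
          MeasureTheory.lintegral_finsetSum' _ fun ξ _ => A.aemeasurable_queries (F ξ) (hF ξ)
      _ ≤ ∑ _ξ : Ξ, ⨆ (f : Plane → ℝ) (_ : IsSmooth f), A.expectedQueries f :=
          Finset.sum_le_sum fun ξ _ => le_iSup₂ (f := fun f (_ : IsSmooth f) => A.expectedQueries f)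
            (F ξ) (hF ξ)
      _ = _ := by simp [mul_comm]
  refine (ENNReal.mul_le_mul_iff_left ?_ ?_).mp h1
  · exact_mod_cast Fintype.card_ne_zero
  · exact ENNReal.natCast_ne_top _

/-- The initial proposal fails for at least one of the two linear functions `±x`. This crude bound
later absorbs the `-1` in `le_queryComplexityRand_of_scale`. -/
theorem half_le_queryComplexityRand {ε : ℝ} (hε : ε < 1) :
    (1 / 2 : ℝ≥0∞) ≤ queryComplexityRand.{u} ε := by
  have hfd : ∀ (σ : ℝ) (z : Plane),
      HasFDerivAt (fun z : Plane => σ * z 0) (planeFunctional σ 0) z := by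
    intro σ z
    refine ((EuclideanSpace.proj 0 : Plane →L[ℝ] ℝ).hasFDerivAt.const_mul σ).congr_fderiv ?_
    simp [planeFunctional]
  have hone : ∀ (A : DetAlgorithm) (f : Plane → ℝ), ¬ IsStationaryPoint f ε (A.output []) →
      1 ≤ A.queries f ε := by
    intro A f hf
    refine le_iInf₂ fun t ht => ?_
    have : t ≠ 0 := by rintro rfl; exact hf ht
    exact_mod_cast Nat.one_le_iff_ne_zero.mpr this
  refine le_queryComplexityRand (Ξ := Bool)
    (F := fun b z => (if b then 1 else -1) * z 0) (fun b => ?_) fun A => ?_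
  · exact isSmooth_of_hasFDerivAt (hfd _) fun z _ z' _ => by simp
  · rw [Fintype.sum_bool, Fintype.card_bool, Nat.cast_ofNat,
      ENNReal.div_mul_cancel two_ne_zero ENNReal.ofNat_ne_top]
    have hz := (A.output []).2
    rcases lt_or_ge 0 ((A.output [] : Plane) 0) with h0 | h0
    · refine le_add_right (hone A _ ?_)
      refine not_isStationaryPoint_of_descent (v := !₂[-1, 0]) (hfd _ _) h0 hz ?_ ?_
      · intro i
        fin_cases i
        · simp
        · simpa using hz 1
      · have hn : ‖(!₂[-1, 0] : Plane)‖ = 1 := by simp [EuclideanSpace.norm_eq]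
        rw [hn, planeFunctional_apply]
        simpa using hε
    · refine le_add_left (hone A _ ?_)
      refine not_isStationaryPoint_of_descent (v := !₂[1, 0]) (t₀ := 1) (hfd _ _) one_pos hz ?_ ?_
      · intro i
        have := (hz 0).1
        fin_cases i
        · simp
          constructor <;> linarith
        · simpa using hz 1
      · have hn : ‖(!₂[1, 0] : Plane)‖ = 1 := by simp [EuclideanSpace.norm_eq]
        rw [hn, planeFunctional_apply]
        simpa using hε

/-! ### The lower bound for general `h` -/

theorem sumRecip_mono {h : ℕ → ℝ} (hh : ∀ k, 1 ≤ k → 0 < h k) {m n : ℕ} (hmn : m ≤ n) :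
    sumRecip h m ≤ sumRecip h n :=
  Finset.sum_le_sum_of_subset_of_nonneg (Finset.Icc_subset_Icc_right hmn) fun k hk _ => by
    have := hh k (Finset.mem_Icc.mp hk).1
    positivity

theorem sumRecip_pos {h : ℕ → ℝ} (hh : ∀ k, 1 ≤ k → 0 < h k) {n : ℕ} (hn : 1 ≤ n) :
    0 < sumRecip h n :=
  Finset.sum_pos (fun k hk => by
    have hk := (Finset.mem_Icc.mp hk).1
    have := hh k hk
    positivity) ⟨1, Finset.mem_Icc.mpr ⟨le_rfl, hn⟩⟩

/-- Cauchy condensation: this is where the convergence of `∑ h k / k` enters. -/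
theorem exists_scale {h : ℕ → ℝ} (hh : ∀ k, 1 ≤ k → 0 < h k) (hanti : AntitoneOn h (Set.Ici 1))
    (hsum : Summable fun k : ℕ => h k / (k : ℝ)) :
    ∃ c : ℝ, 0 < c ∧ ∀ n, ∑ j ∈ Finset.range n, c * h (2 ^ j) ≤ 1 / 2 := by
  have hcond : Summable fun j : ℕ => h (2 ^ j) := by
    have := (summable_condensed_iff_of_nonneg (f := fun k : ℕ => h k / (k : ℝ)) ?_ ?_).mpr hsum
    · refine this.congr fun j => ?_
      push_cast
      field_simp
    · intro k
      rcases Nat.eq_zero_or_pos k with rfl | hk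
      · simp
      · have := hh k hk
        positivity
    · intro m n hm hmn
      have h1 := hh m hm
      have h2 : h n ≤ h m := hanti (Set.mem_Ici.mpr hm) (Set.mem_Ici.mpr (hm.trans_le hmn)) hmn
      have h3 : (0 : ℝ) < m := by exact_mod_cast hm
      gcongr
  have hpos : ∀ j, 0 ≤ h (2 ^ j) := fun j => (hh _ Nat.one_le_two_pow).le
  have hH : 0 ≤ ∑' j, h (2 ^ j) := tsum_nonneg hpos
  refine ⟨1 / (2 * (∑' j, h (2 ^ j) + 1)), by positivity, fun n => ?_⟩
  rw [← Finset.mul_sum, one_div_mul_eq_div, div_le_div_iff₀ (by positivity) two_pos]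
  have := hcond.sum_le_tsum (Finset.range n) fun j _ => hpos j
  linarith

theorem column_le {w : ℝ} (hw : 0 < w) (z : unitSquare) : column w z ≤ ⌊1 / w⌋₊ :=
  Nat.floor_le_floor (by have := (z.2 0).2; gcongr)

/-- The lower bound for deterministic algorithms, on average over the random valley. -/
theorem le_queryComplexityRand_of_scale {h : ℕ → ℝ} {c w ε : ℝ} {N : ℕ}
    (hh : ∀ k, 1 ≤ k → 0 < h k) (hanti : AntitoneOn h (Set.Ici 1)) (hc : 0 < c)
    (hsum : ∀ n, ∑ j ∈ Finset.range n, c * h (2 ^ j) ≤ 1 / 2) (hw : 0 < w) (hw1 : w ≤ 1 / 40)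
    (hε : 1600 * ε = w ^ 2) (hN : N = ⌊1 / w⌋₊) :
    ENNReal.ofReal (N / (8 * ((17 / c + h 1) * sumRecip h N)) - 1) ≤ queryComplexityRand.{u} ε := by
  have hε0 : 0 < ε := by nlinarith
  have hh1 := hh 1 le_rfl
  set R := ⌈c * h 1 * N⌉₊ + 1 with hR
  have hRN : c * h 1 * N ≤ R := (Nat.le_ceil _).trans (by rw [hR]; push_cast; linarith)
  have hN1 : 1 ≤ N := by
    rw [hN, Nat.one_le_floor_iff, one_le_div hw]
    linarith
  have hS := sumRecip_pos hh hN1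
  set a : ℕ → ℝ := fun j => c * h (2 ^ j) with ha
  have ha0 : ∀ j, 0 ≤ a j := fun j => mul_nonneg hc.le (hh _ Nat.one_le_two_pow).le
  set C := 17 / c + h 1 with hC
  have hC0 : 0 < C := by positivity
  have : Nonempty (Fin R) := ⟨⟨0, Nat.succ_pos _⟩⟩
  refine le_queryComplexityRand (Ξ := Fin (N + 1) × Fin (N + 1) → Fin R)
    (F := fun ξ => valley ε w (curve a w ξ)) (fun ξ => ?_) fun A => ?_
  · exact valley_isSmooth hw (by linarith) hε (hasDerivAt_curve ξ hw)
      (curveSlope_mem_Icc ξ ha0 (hsum _)) (abs_curveSlope_sub_le ξ hw ha0 (hsum _))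
  by_cases htop : ∃ ξ : Fin (N + 1) × Fin (N + 1) → Fin R,
      A.queries (valley ε w (curve a w ξ)) ε = ⊤
  · obtain ⟨ξ, hξ⟩ := htop
    rw [ENNReal.sum_eq_top.mpr ⟨ξ, Finset.mem_univ _, hξ⟩]
    exact le_top
  have hT : ∀ ξ : Fin (N + 1) × Fin (N + 1) → Fin R, ∃ T : ℕ,
      A.queries (valley ε w (curve a w ξ)) ε = T ∧ IsStationaryPoint (valley ε w (curve a w ξ)) ε
        (A.output (A.answers (valley ε w (curve a w ξ)) T)) := fun ξ =>
    (A.queries_eq_top_or _ ε).resolve_left fun h => htop ⟨ξ, h⟩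
  choose T hTq hTs using hT
  have hs : ∀ s ∈ Finset.range N,
      (Fintype.card (Fin (N + 1) × Fin (N + 1) → Fin R) : ℝ) / 4 ≤
      ∑ ξ, ∑ t ∈ Finset.range (T ξ + 1),
        (hitBound C h w s (A.output (A.answers (valley ε w (curve a w ξ)) t)) +
          hitBound C h w s (A.query (A.answers (valley ε w (curve a w ξ)) t))) := by
    intro s hs
    refine quarter_le_sum_hitBound (F := fun ξ => valley ε w (curve a w ξ))
      (f₀ := fun z => ε * (4 * (z 0 + z 1))) (col := column w)
      (Hit := fun ξ => NearCurve w (curve a w ξ)) A s (hitBound_nonneg hC0.le hh w s)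
      (fun ξ z hz => valley_of_far hw (not_le.mp hz)) (fun Z P hZP => ?_) T fun ξ => ?_
    · exact card_hit_le_sum_hitBound (V := fun g => valley ε w g)
        (fun g g' z e => by simp only [valley, e]) hh hanti hc hw hN (Nat.succ_pos _) hRN s Z P hZP
    · have hst := valley_stationary hw hw1 hε0 (hasDerivAt_curve ξ hw)
        (curveSlope_mem_Icc ξ ha0 (hsum _)) (curve_zero ξ) (hTs ξ)
      refine ⟨?_, hst.2⟩
      -- A stationary point has first coordinate `1`, hence lies in column `N`, beyond every `s <
      -- N`.
      rw [column, hst.1, ← hN]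
      exact Finset.mem_range.mp hs
  -- Summing over columns: each of the `T ξ + 1` steps has one output and one query, each worth at
  -- most `C * sumRecip h N`.
  have htotal : (N : ℝ) * (Fintype.card (Fin (N + 1) × Fin (N + 1) → Fin R) / 4) ≤
      ∑ ξ, ((T ξ : ℝ) + 1) * (2 * (C * sumRecip h N)) := by
    have h1 := Finset.sum_le_sum hs
    rw [Finset.sum_const, Finset.card_range, nsmul_eq_mul, Finset.sum_comm] at h1
    refine h1.trans (Finset.sum_le_sum fun ξ _ => ?_)
    rw [Finset.sum_comm]
    have h2 : ∀ z : unitSquare, ∑ s ∈ Finset.range N, hitBound C h w s z ≤ C * sumRecip h N :=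
      fun z => sum_hitBound_le hC0.le hh (hN ▸ column_le hw z)
    refine (Finset.sum_le_sum (g := fun _ => 2 * (C * sumRecip h N)) fun t _ => ?_).trans ?_
    · rw [Finset.sum_add_distrib]
      linarith [h2 (A.output (A.answers (valley ε w (curve a w ξ)) t)),
        h2 (A.query (A.answers (valley ε w (curve a w ξ)) t))]
    · simp
  rw [Finset.sum_congr rfl fun ξ _ => hTq ξ, ← Nat.cast_sum]
  set M := Fintype.card (Fin (N + 1) × Fin (N + 1) → Fin R) with hM
  rw [← Finset.sum_mul, Finset.sum_add_distrib, Finset.sum_const, Finset.card_univ, ← hM,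
    nsmul_eq_mul, mul_one, ← Nat.cast_sum] at htotal
  rw [← ENNReal.ofReal_natCast, ← ENNReal.ofReal_natCast, ← ENNReal.ofReal_mul' (by positivity)]
  refine ENNReal.ofReal_le_ofReal ?_
  have hCS : 0 < C * sumRecip h N := mul_pos hC0 hS
  rw [sub_mul, one_mul, sub_le_iff_le_add, div_mul_eq_mul_div, div_le_iff₀ (by positivity)]
  linarith

theorem exists_le_queryComplexityRand {h : ℕ → ℝ} (hh : ∀ k, 1 ≤ k → 0 < h k)
    (hanti : AntitoneOn h (Set.Ici 1)) (hsum : Summable fun k : ℕ => h k / (k : ℝ)) :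
    ∃ c : ℝ, 0 < c ∧ ∀ᶠ ε : ℝ in 𝓝[>] 0,
      ENNReal.ofReal (c * (1 / (√ε * sumRecip h ⌈1 / √ε⌉₊))) ≤ queryComplexityRand.{u} ε := by
  obtain ⟨c, hc, hcs⟩ := exists_scale hh hanti hsum
  have hh1 := hh 1 le_rfl
  set C := 17 / c + h 1 with hC
  have hC0 : 0 < C := by positivity
  -- `1920 = 80 * 8 * 3`: from `N ≥ 1 / (80√ε)`, from the constant in `B`, and from replacing `B -
  -- 1` by `B / 3`.
  refine ⟨1 / (1920 * C), by positivity, ?_⟩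
  filter_upwards [Ioo_mem_nhdsGT (by norm_num : (0 : ℝ) < 1 / 1600 ^ 2)] with ε hε
  have hs0 : 0 < √ε := Real.sqrt_pos.mpr hε.1
  have hs1 : √ε ≤ 1 / 1600 := by
    rw [Real.sqrt_le_left (by norm_num)]
    linarith [hε.2]
  have hsq : √ε ^ 2 = ε := Real.sq_sqrt hε.1.le
  set N := ⌊1 / (40 * √ε)⌋₊ with hN
  have hmain := le_queryComplexityRand_of_scale.{u} (w := 40 * √ε) (ε := ε) hh hanti hc hcs
    (by positivity) (by linarith) (by rw [mul_pow, hsq]; ring) hN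
  rw [← hC] at hmain
  have hhalf := half_le_queryComplexityRand.{u} (ε := ε) (by linarith [hε.2])
  have hw2 : 2 ≤ 1 / (40 * √ε) := by
    rw [le_div_iff₀ (by positivity)]
    linarith
  have hNge : 1 / (80 * √ε) ≤ N := by
    have h1 := Nat.lt_floor_add_one (1 / (40 * √ε))
    have h2 : 1 / (40 * √ε) = 2 * (1 / (80 * √ε)) := by field_simp; norm_num
    rw [← hN] at h1
    linarith
  have hN1 : 1 ≤ N := Nat.one_le_floor_iff _ |>.mpr (by linarith)
  have hNle : N ≤ ⌈1 / √ε⌉₊ := by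
    refine (Nat.floor_le_floor (one_div_le_one_div_of_le hs0 (by linarith))).trans
      (Nat.floor_le_ceil _)
  have hSN := sumRecip_pos hh hN1
  have hS := sumRecip_mono hh hNle
  set B := N / (8 * (C * sumRecip h N)) with hB
  have hle : 1 / (1920 * C) * (1 / (√ε * sumRecip h ⌈1 / √ε⌉₊)) ≤ B / 3 := by
    calc _ ≤ 1 / (1920 * C) * (1 / (√ε * sumRecip h N)) := by gcongr
      _ = 1 / (80 * √ε) / (8 * (C * sumRecip h N)) / 3 := by field_simp; norm_num
      _ ≤ B / 3 := by rw [hB]; gcongr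
  refine (ENNReal.ofReal_le_ofReal hle).trans ?_
  -- Small `B` is covered by the bound `1/2`; for large `B`, `B - 1 ≥ B / 3`.
  rcases le_total B (3 / 2) with h | h
  · refine le_trans ?_ hhalf
    rw [show (1 / 2 : ℝ≥0∞) = ENNReal.ofReal (1 / 2) by
      rw [ENNReal.ofReal_div_of_pos two_pos]; simp]
    exact ENNReal.ofReal_le_ofReal (by linarith)
  · exact (ENNReal.ofReal_le_ofReal (by linarith)).trans hmain

/-! ### The choice of `h` giving the cubic logarithm -/

/-- A decreasing function for which `∑ h k / k` converges slowly. -/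
noncomputable def invSqLog (k : ℕ) : ℝ := 1 / ((Nat.log 2 k : ℝ) + 1) ^ 2

theorem invSqLog_pos (k : ℕ) : 0 < invSqLog k := by unfold invSqLog; positivity

theorem antitone_invSqLog : Antitone invSqLog := by
  intro m n hmn
  unfold invSqLog
  have : (Nat.log 2 m : ℝ) ≤ Nat.log 2 n := by exact_mod_cast Nat.log_mono_right hmn
  gcongr

theorem summable_invSqLog_div : Summable fun k : ℕ => invSqLog k / (k : ℝ) := by
  refine (summable_condensed_iff_of_nonneg
    (fun k => div_nonneg (invSqLog_pos k).le k.cast_nonneg) fun m n hm hmn => ?_).mp ?_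
  · have h1 := antitone_invSqLog hmn
    have h2 := (invSqLog_pos m).le
    have h3 : (0 : ℝ) < m := by exact_mod_cast hm
    gcongr
  · have h := (summable_nat_add_iff 1).mpr (Real.summable_one_div_nat_pow.mpr one_lt_two)
    refine h.congr fun j => ?_
    rw [invSqLog, Nat.log_pow one_lt_two]
    push_cast
    field_simp

/-- The factor `1 / h k` is largest at `k = n`; what remains is the harmonic sum. -/
theorem sumRecip_invSqLog_le (n : ℕ) :
    sumRecip invSqLog n ≤ ((Nat.log 2 n : ℝ) + 1) ^ 2 * (1 + Real.log n) := by
  have hharm : ∑ k ∈ Finset.Icc 1 n, 1 / (k : ℝ) ≤ 1 + Real.log n := by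
    have := harmonic_le_one_add_log n
    rw [harmonic_eq_sum_Icc] at this
    push_cast at this
    simpa using this
  refine le_trans ?_ (mul_le_mul_of_nonneg_left hharm (by positivity))
  rw [sumRecip, Finset.mul_sum]
  refine Finset.sum_le_sum fun k hk => ?_
  obtain ⟨hk1, hkn⟩ := Finset.mem_Icc.mp hk
  have h1 : (Nat.log 2 k : ℝ) ≤ Nat.log 2 n := by exact_mod_cast Nat.log_mono_right hkn
  have h2 : (0 : ℝ) < k := by exact_mod_cast hk1
  calc 1 / ((k : ℝ) * invSqLog k) = ((Nat.log 2 k : ℝ) + 1) ^ 2 * (1 / k) := by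
        unfold invSqLog; field_simp
    _ ≤ _ := by gcongr

theorem sumRecip_invSqLog_ceil_le {ε : ℝ} (hε : 0 < ε) (hL : 2 ≤ Real.log (1 / ε)) :
    sumRecip invSqLog ⌈1 / √ε⌉₊ ≤ 50 * Real.log (1 / ε) ^ 3 := by
  set L := Real.log (1 / ε)
  set n := ⌈1 / √ε⌉₊ with hn
  have hs0 : 0 < √ε := Real.sqrt_pos.mpr hε
  have hε1 : ε ≤ 1 := by
    by_contra hc
    have : L ≤ 0 := Real.log_nonpos (by positivity) ((div_le_one hε).mpr (not_le.mp hc).le)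
    linarith
  have hs1 : √ε ≤ 1 := Real.sqrt_le_one.mpr hε1
  have h1 : 1 ≤ 1 / √ε := (one_le_div hs0).mpr hs1
  have hn0 : (0 : ℝ) < n := lt_of_lt_of_le (by positivity) (Nat.le_ceil (1 / √ε))
  have hn2 : (n : ℝ) ≤ 2 * (1 / √ε) := by
    have := Nat.ceil_lt_add_one (by positivity : 0 ≤ 1 / √ε)
    linarith
  have hlog2 := Real.log_two_lt_d9
  have hlog2' := Real.log_two_gt_d9
  have hlogn : Real.log n ≤ L := by
    have h2 := Real.log_le_log hn0 hn2
    rw [Real.log_mul two_ne_zero (by positivity), one_div, Real.log_inv, Real.log_sqrt hε.le] at h2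
    have h3 : L = -Real.log ε := by simp only [L, one_div, Real.log_inv]
    linarith
  have hnl : (Nat.log 2 n : ℝ) ≤ 2 * L := by
    have h2 : ((2 ^ Nat.log 2 n : ℕ) : ℝ) ≤ n := by
      exact_mod_cast Nat.pow_log_le_self 2 (by exact_mod_cast hn0.ne')
    have h3 := Real.log_le_log (by positivity) h2
    push_cast at h3
    rw [Real.log_pow] at h3
    have h4 : (0 : ℝ) ≤ Nat.log 2 n := by positivity
    nlinarith
  calc _ ≤ ((Nat.log 2 n : ℝ) + 1) ^ 2 * (1 + Real.log n) := sumRecip_invSqLog_le n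
    _ ≤ (2 * L + L) ^ 2 * (L + L) := by gcongr <;> linarith
    _ ≤ 50 * L ^ 3 := by nlinarith [pow_pos (by linarith : 0 < L) 3]

theorem mainTheorem4 :
    (∀ h : ℕ → ℝ, (∀ k, 1 ≤ k → 0 < h k) → AntitoneOn h (Set.Ici 1) →
      Summable (fun k : ℕ => h k / (k : ℝ)) →
      ∃ c : ℝ, 0 < c ∧ ∀ᶠ ε : ℝ in 𝓝[>] 0,
        ENNReal.ofReal (c * (1 / (√ε * sumRecip h ⌈1 / √ε⌉₊))) ≤ queryComplexityRand.{u} ε) ∧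
    (∃ c : ℝ, 0 < c ∧ ∀ᶠ ε : ℝ in 𝓝[>] 0,
      ENNReal.ofReal (c * (1 / (√ε * Real.log (1 / ε) ^ 3))) ≤ queryComplexityRand.{u} ε) := by
  refine ⟨fun h hh hanti hsum => exists_le_queryComplexityRand hh hanti hsum, ?_⟩
  obtain ⟨c, hc, hev⟩ := exists_le_queryComplexityRand.{u} (fun k _ => invSqLog_pos k)
    (antitone_invSqLog.antitoneOn _) summable_invSqLog_div
  refine ⟨c / 50, by positivity, ?_⟩
  have hlog : ∀ᶠ ε : ℝ in 𝓝[>] 0, 2 ≤ Real.log (1 / ε) := by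
    have := Real.tendsto_log_atTop.comp tendsto_inv_nhdsGT_zero
    filter_upwards [this.eventually_ge_atTop 2] with ε hε
    simpa using hε
  filter_upwards [hev, hlog, self_mem_nhdsWithin] with ε h1 h2 (h3 : 0 < ε)
  refine (ENNReal.ofReal_le_ofReal ?_).trans h1
  have hs0 : 0 < √ε := Real.sqrt_pos.mpr h3
  have hS : 0 < sumRecip invSqLog ⌈1 / √ε⌉₊ :=
    sumRecip_pos (fun k _ => invSqLog_pos k) (Nat.ceil_pos.mpr (by positivity))
  have hle := sumRecip_invSqLog_ceil_le h3 h2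
  have : c / 50 * (1 / (√ε * Real.log (1 / ε) ^ 3)) =
      c * (1 / (√ε * (50 * Real.log (1 / ε) ^ 3))) := by
    field_simp
  rw [this]
  gcongr
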